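/- For a finite group $G$, the essential dimension $\operatorname{ed}(G)$ (over $\mathbb{C}$) is the minimal dimension of a complex algebraic variety $X$ with a faithful action of $G$ for which there exist a finite-dimensional complex vector space $V$ with a linear action of $G$ and a $G$-equivariant dominant rational map $V \dashrightarrow X$. Let $G = C_{13} \rtimes C_3$ be the semidirect product of $C_{13} = \langle a \rangle$ and $C_3 = \langle b \rangle$, where $b$ acts on $C_{13}$ by $a \mapsto a^3$ (the group with GAP Id $(39,1)$). Then $\operatorname{ed}(G) = 2$. Moreover, $G$ is not cyclic, and it is not isomorphic to a dihedral group of order $2n$ with $n$ odd. Let $T = (\mathbb{C}^*)^2$, with the action of $\operatorname{GL}_2(\mathbb{Z})$ by $(A\cdot t)_i = \prod_j t_j^{A_{ij}}$, let $m = \begin{pmatrix} 0 & -1 \\ 1 & -1 \end{pmatrix}$, and let $\mathcal{G}_3 = \left\langle m, \begin{pmatrix} 0 & -1 \\ -1 & 0 \end{pmatrix} \right\rangle \subset \operatorname{GL}_2(\mathbb{Z})$. The element $m$ has order $3$, and the $13$-torsion subgroup $T[13]$ of $T$ is isomorphic to $C_{13} \times C_{13}$. There are generators $a_1, a_2$ of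 $T[13]$ with $m a_1 m^{-1} = a_2^{-1}$ and $m a_2 m^{-1} = a_1 a_2^{-1}$ in $T \rtimes \mathcal{G}_3$, and $a \mapsto a_1 a_2^3$, $b \mapsto m$ defines an injective homomorphism from $G$ to the subgroup $T[13] \rtimes \langle m \rangle$ of $T \rtimes \mathcal{G}_3$, whose image meets $T$ in a subgroup of order prime to $3$. -/

import Mathlib

open CategoryTheory AlgebraicGeometry

noncomputable section

namespace EssDim

/-! ### Complex varieties with a group action -/

/-- The base scheme `Spec ℂ`. -/
abbrev SpecC : Scheme.{0} := Spec (CommRingCat.of ℂ)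

/-- A complex algebraic variety: an integral separated scheme of finite type over `ℂ`.
(A variety dominated by an affine space is automatically irreducible, so irreducibility is no
restriction on the varieties considered below.) -/
structure IsVariety (X : Over SpecC) : Prop where
  isIntegral : IsIntegral X.left
  isSeparated : IsSeparated X.hom
  locallyOfFiniteType : LocallyOfFiniteType X.hom
  quasiCompact : QuasiCompact X.hom

/-- The affine space `ℂⁿ` as a scheme over `ℂ`. -/
def affineSpace (n : ℕ) : Over SpecC :=
  Over.mk (Spec.map (CommRingCat.ofHom (algebraMap ℂ (MvPolynomial (Fin n) ℂ))))

instance (n : ℕ) : IsIntegral (affineSpace n).left :=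
  inferInstanceAs (IsIntegral (Spec (CommRingCat.of (MvPolynomial (Fin n) ℂ))))

/-- The pull-back of polynomial functions along the linear map `v ↦ A v`: the coordinate `xᵢ` goes
to the linear form `∑ⱼ Aᵢⱼ xⱼ`. -/
def linSubst {n : ℕ} (A : Matrix (Fin n) (Fin n) ℂ) :
    MvPolynomial (Fin n) ℂ →ₐ[ℂ] MvPolynomial (Fin n) ℂ :=
  MvPolynomial.aeval fun i => ∑ j, MvPolynomial.C (A i j) * MvPolynomial.X j

theorem eval_linSubst {n : ℕ} (A : Matrix (Fin n) (Fin n) ℂ) (p : MvPolynomial (Fin n) ℂ)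
    (v : Fin n → ℂ) :
    MvPolynomial.eval v (linSubst A p) = MvPolynomial.eval (A.mulVec v) p := by
  induction p using MvPolynomial.induction_on with
  | C a => simp [linSubst]
  | add p q hp hq => simp [hp, hq]
  | mul_X p i hp =>
    rw [map_mul, map_mul, hp, map_mul]
    simp [linSubst, Matrix.mulVec, dotProduct]

theorem linSubst_one {n : ℕ} : linSubst (1 : Matrix (Fin n) (Fin n) ℂ) = AlgHom.id ℂ _ := by
  ext1 i
  apply MvPolynomial.funext
  intro v
  simp [eval_linSubst]

theorem linSubst_mul {n : ℕ} (A B : Matrix (Fin n) (Fin n) ℂ) :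
    linSubst (A * B) = (linSubst B).comp (linSubst A) := by
  ext1 i
  apply MvPolynomial.funext
  intro v
  simp [eval_linSubst]

/-- The linear map `v ↦ A v` as a morphism of `ℂ`-schemes. -/
def linMap {n : ℕ} (A : Matrix (Fin n) (Fin n) ℂ) : affineSpace n ⟶ affineSpace n :=
  Over.homMk (Spec.map (CommRingCat.ofHom (linSubst A).toRingHom)) (by
    dsimp [affineSpace]
    rw [← Spec.map_comp, ← CommRingCat.ofHom_comp]
    congr 2
    exact (linSubst A).comp_algebraMap)

theorem linMap_one {n : ℕ} : linMap (1 : Matrix (Fin n) (Fin n) ℂ) = 𝟙 (affineSpace n) := by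
  ext1
  change Spec.map _ = 𝟙 _
  rw [linSubst_one]
  exact Spec.map_id _

theorem linMap_mul {n : ℕ} (A B : Matrix (Fin n) (Fin n) ℂ) :
    linMap (A * B) = linMap B ≫ linMap A := by
  ext1
  change Spec.map _ = Spec.map _ ≫ Spec.map _
  rw [← Spec.map_comp, ← CommRingCat.ofHom_comp, linSubst_mul]
  rfl

/-- The action of `GLₙ(ℂ)` on the variety `ℂⁿ`. The product of `Aut` is composition of functions,
so that a homomorphism to `Aut X` is a left action on `X`. -/
def linAut (n : ℕ) : GL (Fin n) ℂ →* Aut (affineSpace n) where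
  toFun A :=
    { hom := linMap A.val
      inv := linMap A⁻¹.val
      hom_inv_id := by rw [← linMap_mul, Units.inv_mul, linMap_one]
      inv_hom_id := by rw [← linMap_mul, Units.mul_inv, linMap_one] }
  map_one' := by
    ext1
    exact linMap_one
  map_mul' A B := by
    ext1
    exact linMap_mul A.val B.val

/-- The morphism of schemes `X ⟶ X` by which `g` acts on `X`, for an action `α` of `G`. -/
def actionMap {G : Type*} [Group G] {X : Over SpecC} (α : G →* Aut X) (g : G) : X.left ⟶ X.left :=
  let e : X ≅ X := α g
  e.hom.left

instance isIso_actionMap {G : Type*} [Group G] {X : Over SpecC} (α : G →* Aut X) (g : G) :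
    IsIso (actionMap α g) :=
  let e : X ≅ X := α g
  inferInstanceAs (IsIso ((Over.forget SpecC).map e.hom))

instance isDominant_actionMap {G : Type*} [Group G] {X : Over SpecC} (α : G →* Aut X) (g : G) :
    (actionMap α g).toRationalMap.IsDominant := by
  rw [Scheme.PartialMap.isDominant_toRationalMap_iff]
  change IsDominant (X.left.topIso.hom ≫ actionMap α g)
  infer_instance

/-- A `G`-action `α` on the `ℂ`-scheme `X` is linearizable if there is a `G`-equivariant dominant
rational map (over `ℂ`) from `ℂⁿ`, with a linear action `ρ` of `G`, to `X`. -/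
def IsLinearizable {G : Type*} [Group G] {X : Over SpecC} (α : G →* Aut X) : Prop :=
  ∃ (n : ℕ) (ρ : G →* GL (Fin n) ℂ) (f : (affineSpace n).left ⤏ X.left),
    f.IsDominant ∧
    f.compHom X.hom = (affineSpace n).hom.toRationalMap ∧
    ∀ g : G, (actionMap ((linAut n).comp ρ) g).toRationalMap.comp f = f.compHom (actionMap α g)

/-- The essential dimension of `G` (over `ℂ`): the minimal dimension of a variety with a faithful
linearizable action of `G`. -/
def essentialDimension (G : Type*) [Group G] : ℕ∞ :=
  sInf {d : ℕ∞ | ∃ (X : Over SpecC) (α : G →* Aut X),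
    IsVariety X ∧ Function.Injective α ∧ IsLinearizable α ∧
      topologicalKrullDim X.left = (d : WithBot ℕ∞)}

/-! ### The group `C₁₃ ⋊ C₃` -/

/-- The cyclic group of order `n`, written multiplicatively. -/
abbrev Cyc (n : ℕ) : Type := Multiplicative (ZMod n)

theorem cyc13_pow {m n : ℕ} (h : m ≡ n [MOD 13]) (x : Cyc 13) : x ^ m = x ^ n := by
  have hx : x ^ 13 = 1 := by revert x; decide
  rw [pow_eq_pow_mod m hx, pow_eq_pow_mod n hx, h]

/-- The action of `C₃ = ⟨b⟩` on `C₁₃` in which `b` acts by `x ↦ x ^ 3`: the element `bᵏ` acts by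
`x ↦ x ^ (3 ^ k)`, with inverse `x ↦ x ^ (9 ^ k)`. -/
def cubeAction : Cyc 3 →* MulAut (Cyc 13) where
  toFun k :=
    { toFun := fun x => x ^ (3 ^ (Multiplicative.toAdd k).val)
      invFun := fun x => x ^ (9 ^ (Multiplicative.toAdd k).val)
      left_inv := fun x => by
        refine (pow_mul x _ _).symm.trans ((cyc13_pow ?_ x).trans (pow_one x))
        revert k
        decide
      right_inv := fun x => by
        refine (pow_mul x _ _).symm.trans ((cyc13_pow ?_ x).trans (pow_one x))
        revert k
        decide
      map_mul' := fun x y => mul_pow x y _ }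
  map_one' := by
    ext x
    exact pow_one x
  map_mul' := by
    intro k l
    refine MulEquiv.ext fun x => ?_
    refine (cyc13_pow ?_ x).trans (pow_mul x _ _)
    revert k l
    decide

/-- The group `G = C₁₃ ⋊ C₃`. -/
abbrev G39 : Type := Cyc 13 ⋊[cubeAction] Cyc 3

/-- The generator `a` of `C₁₃`, in `G39`. -/
def genA : G39 := SemidirectProduct.inl (Multiplicative.ofAdd 1)

/-- The generator `b` of `C₃`, in `G39`. -/
def genB : G39 := SemidirectProduct.inr (Multiplicative.ofAdd 1)

/-! ### The group `T ⋊ 𝒢₃` -/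

/-- The two-dimensional torus `(ℂˣ)²`. -/
abbrev Torus : Type := Fin 2 → ℂˣ

/-- The action of an integral matrix on the torus, `(A t)ᵢ = ∏ⱼ tⱼ ^ Aᵢⱼ`. -/
def monomialMap (A : Matrix (Fin 2) (Fin 2) ℤ) (t : Torus) : Torus :=
  fun i => ∏ j, t j ^ A i j

theorem monomialMap_one (t : Torus) : monomialMap 1 t = t := by
  funext i
  simp only [monomialMap, Fin.prod_univ_two]
  match i with
  | 0 => simp
  | 1 => simp

theorem monomialMap_mul (A B : Matrix (Fin 2) (Fin 2) ℤ) (t : Torus) :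
    monomialMap (A * B) t = monomialMap A (monomialMap B t) := by
  funext i
  simp only [monomialMap, Matrix.mul_apply, Fin.sum_univ_two, Fin.prod_univ_two, mul_zpow, zpow_add,
    ← zpow_mul, mul_comm (A i _)]
  exact mul_mul_mul_comm _ _ _ _

/-- `GL₂(ℤ)` acts on the torus by automorphisms. -/
def torusAction : GL (Fin 2) ℤ →* MulAut Torus where
  toFun A :=
    { toFun := monomialMap A.val
      invFun := monomialMap A⁻¹.val
      left_inv := fun t => by rw [← monomialMap_mul, Units.inv_mul, monomialMap_one]
      right_inv := fun t => by rw [← monomialMap_mul, Units.mul_inv, monomialMap_one]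
      map_mul' := fun s t => by
        funext i
        simp [monomialMap, mul_zpow, Finset.prod_mul_distrib] }
  map_one' := MulEquiv.ext monomialMap_one
  map_mul' A B := MulEquiv.ext (monomialMap_mul A.val B.val)

/-- The matrix `m`, of order three. -/
def matM : GL (Fin 2) ℤ where
  val := !![0, -1; 1, -1]
  inv := !![-1, 1; -1, 0]
  val_inv := by decide
  inv_val := by decide

/-- The second generator of `𝒢₃`. -/
def matS : GL (Fin 2) ℤ where
  val := !![0, -1; -1, 0]
  inv := !![0, -1; -1, 0]
  val_inv := by decide
  inv_val := by decide

/-- The subgroup `𝒢₃` of `GL₂(ℤ)`. -/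
def G3 : Subgroup (GL (Fin 2) ℤ) := Subgroup.closure {matM, matS}

/-- The group `T ⋊ 𝒢₃`. -/
abbrev TG3 : Type := Torus ⋊[torusAction.comp G3.subtype] G3

/-- The torus `T` as a subgroup of `T ⋊ 𝒢₃`. -/
def torusInTG3 : Subgroup TG3 := (SemidirectProduct.inl : Torus →* TG3).range

/-- The matrix `m` as an element of `𝒢₃`. -/
def mInG3 : G3 := ⟨matM, Subgroup.subset_closure (Set.mem_insert _ _)⟩

/-- The `13`-torsion subgroup `T[13]` of the torus. -/
def torsion13 : Subgroup Torus := (powMonoidHom 13 : Torus →* Torus).ker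

/-- The subgroup `T[13] ⋊ ⟨m⟩` of `T ⋊ 𝒢₃`. -/
def subgroupH : Subgroup TG3 :=
  torsion13.map SemidirectProduct.inl ⊔ Subgroup.zpowers (SemidirectProduct.inr mInG3)

end EssDim

end

noncomputable section

namespace EssDim

/-! Lower bound. A dominant rational map from affine space embeds the function field `K` of `X` into
`ℂ(x₁, …, xₙ)`. If `dim X ≤ 1`, restricting functions to a suitable line embeds a nonconstant `K`
into `ℂ(t)`, and Lüroth's theorem gives `K ≅ ℂ(t)`; otherwise `K = ℂ`. Automorphisms of `ℂ(t)` are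
Möbius transformations. An element of `PGL₂` conjugate to its cube has eigenvalue ratio `q` with `q³
= q` or `q³ = q⁻¹`, so `q⁴ = 1`; together with `q¹³ = 1` this forces `q = 1`, and characteristic
zero excludes a nontrivial unipotent. So `a` acts trivially on `K`, hence on `X`, and the action is
not faithful (`ratFunc_algEquiv_eq_one`, `exists_algEquiv_ratFunc`, `two_le_topologicalKrullDim`).

Upper bound. In a three-dimensional representation `a` is diagonal and `b` permutes the coordinates
cyclically. The ratios of consecutive coordinates generate an algebra stable under `G`. Its spectrum
is a torus of dimension two on which `a` still acts nontrivially, and every nontrivial normal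
subgroup of `G` contains `a` (`exists_linearizable_surface`).

The embedding into `T ⋊ 𝒢₃` rests on `3² + 3 + 1 = 13`: on the line spanned by `a₁ a₂³` the matrix
`m` acts as multiplication by `3`, a primitive cube root of unity modulo `13`. -/

/-! ### Generators and elementary properties of `C₁₃ ⋊ C₃` -/

theorem exists_monoidHom_of_pow_eq_one {H : Type*} [Group H] (n : ℕ) (x : H) (hx : x ^ n = 1) :
    ∃ f : Cyc n →* H, f (Multiplicative.ofAdd 1) = x := by
  let f : ℤ →+ Additive H := zmultiplesHom (Additive H) (Additive.ofMul x)
  have hf : f n = 0 := by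
    change Additive.ofMul (x ^ (n : ℤ)) = 0
    rw [zpow_natCast, hx]; rfl
  refine ⟨AddMonoidHom.toMultiplicativeLeft (ZMod.lift n ⟨f, hf⟩), ?_⟩
  have := ZMod.lift_coe n ⟨f, hf⟩ 1
  simp only [Int.cast_one] at this
  change Additive.toMul (ZMod.lift n ⟨f, hf⟩ 1) = x
  rw [this]
  change x ^ (1 : ℤ) = x
  simp

theorem cyc_eq_pow (n : ℕ) [NeZero n] (x : Cyc n) :
    x = Multiplicative.ofAdd 1 ^ (Multiplicative.toAdd x).val := by
  apply Multiplicative.toAdd.injective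
  simp

/-- Homomorphisms from `G39` can be defined on the generators. -/
theorem exists_monoidHom_G39 {H : Type*} [Group H] (x y : H) (hx : x ^ 13 = 1) (hy : y ^ 3 = 1)
    (hxy : y * x * y⁻¹ = x ^ 3) : ∃ f : G39 →* H, f genA = x ∧ f genB = y := by
  obtain ⟨f, hf⟩ := exists_monoidHom_of_pow_eq_one 13 x hx
  obtain ⟨g, hg⟩ := exists_monoidHom_of_pow_eq_one 3 y hy
  have key (k : ℕ) : y ^ k * x * (y ^ k)⁻¹ = x ^ 3 ^ k := by
    induction k with
    | zero => simp
    | succ k ih =>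
      calc y ^ (k + 1) * x * (y ^ (k + 1))⁻¹ = y * (y ^ k * x * (y ^ k)⁻¹) * y⁻¹ := by
            rw [pow_succ']; group
        _ = (y * x * y⁻¹) ^ 3 ^ k := by rw [ih, conj_pow]
        _ = _ := by rw [hxy, ← pow_mul, pow_succ']
  refine ⟨SemidirectProduct.lift f g fun k => ?_, ?_, ?_⟩
  · refine MonoidHom.ext fun u => ?_
    change f (u ^ 3 ^ (Multiplicative.toAdd k).val) = g k * f u * (g k)⁻¹
    rw [cyc_eq_pow 13 u, cyc_eq_pow 3 k]
    simp only [map_pow, hf, hg]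
    rw [← conj_pow, ← cyc_eq_pow 3 k, key, ← pow_mul, ← pow_mul, mul_comm]
  · rw [genA, SemidirectProduct.lift_inl, hf]
  · rw [genB, SemidirectProduct.lift_inr, hg]

theorem eq_genA_pow_mul_genB_pow (g : G39) :
    g = genA ^ (Multiplicative.toAdd g.left).val * genB ^ (Multiplicative.toAdd g.right).val := by
  rw [genA, genB, ← map_pow SemidirectProduct.inl, ← map_pow SemidirectProduct.inr, ← cyc_eq_pow 13,
    ← cyc_eq_pow 3, SemidirectProduct.inl_left_mul_inr_right]

theorem genA_pow : genA ^ 13 = 1 := by decide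
theorem genB_conj_genA : genB * genA * genB⁻¹ = genA ^ 3 := by decide

/-- Every nontrivial normal subgroup contains `genA`: for `g ≠ 1`, either `g` or its commutator with
`genA` is a generator of `C₁₃`. Faithfulness thus needs checking on `genA` alone. -/
theorem injective_of_map_genA_ne_one {H : Type*} [Group H] (f : G39 →* H) (hf : f genA ≠ 1) :
    Function.Injective f := by
  have key : ∀ (i : Cyc 13) (k : Cyc 3), (i = 1 ∧ k = 1) ∨
      ∃ n : Fin 13, (⟨i, k⟩ : G39) ^ n.val = genA ∨
        ((⟨i, k⟩ : G39) * (genA * (⟨i, k⟩ : G39)⁻¹ * genA⁻¹)) ^ n.val = genA := by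
    decide
  rw [injective_iff_map_eq_one]
  rintro ⟨i, k⟩ hg
  obtain ⟨rfl, rfl⟩ | ⟨n, h | h⟩ := key i k
  · rfl
  · exact absurd (by rw [← h, map_pow, hg, one_pow]) hf
  · exact absurd (by rw [← h, map_pow, map_mul, map_mul, map_mul, map_inv, map_inv, hg]; simp) hf

theorem not_isCyclic_G39 : ¬ IsCyclic G39 := by
  intro h
  have hc : genA * genB = genB * genA := h.commGroup.mul_comm genA genB
  exact absurd hc (by decide)

theorem card_G39 : Nat.card G39 = 39 := by
  rw [SemidirectProduct.card]; simp

theorem isEmpty_G39_mulEquiv_dihedralGroup (n : ℕ) : IsEmpty (G39 ≃* DihedralGroup n) := by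
  refine ⟨fun e => ?_⟩
  have := Nat.card_congr e.toEquiv
  rw [card_G39, DihedralGroup.nat_card] at this
  -- 39 is odd. The case `n = 0` is covered as well: the infinite group has `Nat.card` equal to `0 =
  -- 2 * 0`.
  omega

theorem orderOf_mInG3 : orderOf mInG3 = 3 := by
  refine orderOf_eq_prime ?_ ?_
  · apply Subtype.ext; apply Units.ext; decide
  · intro h
    have := congrArg (fun x : G3 => (x.1.1 0 0)) h
    revert this
    decide

/-! ### Elements of order 13 in `PGL₂` -/

theorem Matrix.sq_eq_of_fin_two {R : Type*} [CommRing R] (A : Matrix (Fin 2) (Fin 2) R) :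
    A ^ 2 = A.trace • A - A.det • 1 := by
  rw [pow_two]
  ext i j
  fin_cases i <;> fin_cases j <;>
    simp [Matrix.mul_apply, Fin.sum_univ_two, Matrix.trace_fin_two, Matrix.det_fin_two] <;> ring

/-- An element of `PGL₂` with trivial thirteenth power which is conjugate to its cube is trivial. -/
theorem exists_eq_smul_one_of_conj_pow_three {k : Type*} [Field k] [CharZero k]
    (A B : Matrix (Fin 2) (Fin 2) k) (hA : A.det ≠ 0) (hB : B.det ≠ 0) (c d : k)
    (h13 : A ^ 13 = c • 1) (hAB : A ^ 3 * B = d • (B * A)) : ∃ s : k, A = s • 1 := by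
  set T := A.trace with hT
  set D := A.det with hD
  have h2 : A ^ 2 = T • A - D • 1 := Matrix.sq_eq_of_fin_two A
  have h3 : A ^ 3 = (T ^ 2 - D) • A - (T * D) • 1 := by
    rw [pow_succ, h2, sub_mul, smul_mul_assoc, ← pow_two, h2]
    simp only [smul_mul_assoc, one_mul]
    module
  have hconj : A ^ 3 = d • (B * A * B⁻¹) := by
    rw [← smul_mul_assoc, ← hAB, mul_assoc, Matrix.mul_nonsing_inv _ (Ne.isUnit hB), mul_one]
  have htr : (A ^ 3).trace = d * T := by
    rw [hconj, Matrix.trace_smul, mul_assoc, Matrix.trace_mul_comm, mul_assoc,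
      Matrix.nonsing_inv_mul _ (Ne.isUnit hB), mul_one, smul_eq_mul]
  have hdet : D ^ 2 = d ^ 2 := by
    have h := congrArg Matrix.det hAB
    rw [Matrix.det_mul, Matrix.det_pow, Matrix.det_smul, Matrix.det_mul, Fintype.card_fin] at h
    refine mul_right_cancel₀ (mul_ne_zero hA hB) ?_
    linear_combination h
  have htr' : T * (T ^ 2 - 3 * D) = d * T := by
    rw [← htr, h3, Matrix.trace_sub, Matrix.trace_smul, Matrix.trace_smul, Matrix.trace_one]
    simp; ring
  have key : ∀ s t : k, s ≠ 0 → s • A = t • (1 : Matrix (Fin 2) (Fin 2) k) →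
      ∃ s : k, A = s • 1 := fun s t hs h =>
    ⟨s⁻¹ * t, by rw [mul_smul, ← h, smul_smul, inv_mul_cancel₀ hs, one_smul]⟩
  -- Determinants give `d = ±D`, and the two expressions for the trace of `A ^ 3` give `T ^ 2 - 3 *
  -- D = d` unless `T = 0`. The three cases are eigenvalue ratio `-1`, `1` and a primitive fourth
  -- root of unity. In each, `A ^ 13` is a scalar plus a nonzero multiple of `A`, so `A` is scalar.
  have hcase : T = 0 ∨ T ^ 2 = 4 * D ∨ T ^ 2 = 2 * D := by
    by_cases h0 : T = 0
    · exact Or.inl h0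
    · have h1 : T ^ 2 - 3 * D = d := mul_left_cancel₀ h0 (by linear_combination htr')
      obtain h | h := sq_eq_sq_iff_eq_or_eq_neg.1 hdet
      · exact Or.inr (Or.inl (by linear_combination h1 - h))
      · exact Or.inr (Or.inr (by linear_combination h1 + h))
  clear_value T D
  have h13' : A ^ 13 = (A ^ 2) ^ 6 * A := by rw [← pow_mul, ← pow_succ]
  obtain h0 | h0 | h0 := hcase
  · refine key (D ^ 6) c (pow_ne_zero _ hA) ?_
    rw [← h13, h13', h2, h0, zero_smul, zero_sub, ← neg_smul, smul_pow, one_pow, smul_mul_assoc,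
      one_mul]
    congr 1; ring
  -- Double eigenvalue `t`: the coefficient of `A` in `A ^ 13` is `13 * t ^ 12`, nonzero in
  -- characteristic zero.
  · obtain ⟨t, rfl⟩ : ∃ t, T = 2 * t := ⟨T / 2, by field_simp⟩
    have hDt : D = t ^ 2 := by
      refine mul_left_cancel₀ (by norm_num : (4 : k) ≠ 0) ?_
      linear_combination -h0
    have hn : ∀ n : ℕ, A ^ (n + 1) = ((n + 1) * t ^ n) • A - (n * t ^ (n + 1)) • 1 := by
      intro n
      induction n with
      | zero => simp
      | succ n ih =>
        rw [pow_succ, ih, sub_mul, smul_mul_assoc, ← pow_two, h2, hDt]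
        simp only [smul_mul_assoc, one_mul]
        push_cast
        module
    have h12 := hn 12
    rw [h13] at h12
    have ht : t ≠ 0 := by
      rintro rfl
      exact hA (by rw [hDt]; ring)
    refine key (13 * t ^ 12) (c + 12 * t ^ 13) (by simp [ht]) ?_
    rw [add_smul, h12]
    push_cast
    module
  · have h4 : (A ^ 2) ^ 2 = (-(D ^ 2)) • 1 := by
      rw [h2, pow_two, sub_mul, mul_sub, mul_sub, smul_mul_smul_comm, ← pow_two A, h2]
      simp only [smul_mul_assoc, one_mul, mul_smul_comm, mul_one]
      have : T * T = 2 * D := by linear_combination h0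
      rw [this]
      have : (2 * D) * T - 2 * D * T = 0 := by ring
      module
    refine key (-(D ^ 6)) c (neg_ne_zero.2 (pow_ne_zero _ hA)) ?_
    have h12 : (A ^ 2) ^ 6 = (-(D ^ 6)) • 1 := by
      rw [show (A ^ 2) ^ 6 = ((A ^ 2) ^ 2) ^ 3 from pow_mul _ 2 3, h4, smul_pow, one_pow]
      congr 1; ring
    rw [← h13, h13', h12, smul_mul_assoc, one_mul]

/-! ### Automorphisms of the field of rational functions -/

/-- The rational function `y` is the fraction `(a X + b) / (c X + d)` defined by the invertible
matrix `M`. -/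
def IsMoebius {k : Type*} [Field k] (M : GL (Fin 2) k) (y : RatFunc k) : Prop :=
  (RatFunc.C (M 1 0) * RatFunc.X + RatFunc.C (M 1 1)) * y =
    RatFunc.C (M 0 0) * RatFunc.X + RatFunc.C (M 0 1)

variable {k : Type*} [Field k]

theorem RatFunc.linear_eq_zero_iff {a b : k} :
    RatFunc.C a * RatFunc.X + RatFunc.C b = 0 ↔ a = 0 ∧ b = 0 := by
  refine ⟨fun h => ?_, fun h => by simp [h]⟩
  have h' : Polynomial.C a * Polynomial.X + Polynomial.C b = 0 := by
    apply RatFunc.algebraMap_injective k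
    simpa using h
  constructor
  · simpa using congrArg (Polynomial.coeff · 1) h'
  · simpa using congrArg (Polynomial.coeff · 0) h'

theorem RatFunc.algHom_C (σ : RatFunc k →ₐ[k] RatFunc k) (a : k) :
    σ (RatFunc.C a) = RatFunc.C a := by
  rw [← RatFunc.algebraMap_eq_C, σ.commutes]

theorem RatFunc.algHom_ext {σ τ : RatFunc k →ₐ[k] RatFunc k} (h : σ RatFunc.X = τ RatFunc.X) :
    σ = τ := by
  have : (σ : RatFunc k →+* RatFunc k).comp (algebraMap (Polynomial k) (RatFunc k)) =
      (τ : RatFunc k →+* RatFunc k).comp (algebraMap (Polynomial k) (RatFunc k)) := by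
    apply Polynomial.ringHom_ext
    · intro a; simp [RatFunc.algHom_C]
    · simpa using h
  have h2 := IsLocalization.ringHom_ext (nonZeroDivisors (Polynomial k)) this
  exact AlgHom.ext fun x => congrArg (fun f : RatFunc k →+* RatFunc k => f x) h2

theorem RatFunc.algEquiv_C (σ : RatFunc k ≃ₐ[k] RatFunc k) (a : k) :
    σ (RatFunc.C a) = RatFunc.C a :=
  RatFunc.algHom_C σ.toAlgHom a

/-- Field automorphisms act by substitution: `σ` turns `τ X`, a fraction in `X`, into the same
fraction in `σ X`. Hence the matrices multiply in the opposite order. -/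
theorem IsMoebius.mul {A B : GL (Fin 2) k} {σ τ : RatFunc k ≃ₐ[k] RatFunc k}
    (hA : IsMoebius A (σ RatFunc.X)) (hB : IsMoebius B (τ RatFunc.X)) :
    IsMoebius (B * A) ((σ * τ) RatFunc.X) := by
  unfold IsMoebius at *
  have h := congrArg σ hB
  simp only [map_mul, map_add, RatFunc.algEquiv_C] at h
  simp only [Units.val_mul, Matrix.mul_apply, Fin.sum_univ_two, map_add, map_mul,
    AlgEquiv.mul_apply]
  linear_combination (RatFunc.C (A 1 0) * RatFunc.X + RatFunc.C (A 1 1)) * h +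
    (RatFunc.C (B 0 0) - RatFunc.C (B 1 0) * σ (τ RatFunc.X)) * hA

theorem isMoebius_one : IsMoebius (1 : GL (Fin 2) k) RatFunc.X := by
  simp [IsMoebius]

theorem IsMoebius.pow {A : GL (Fin 2) k} {σ : RatFunc k ≃ₐ[k] RatFunc k}
    (hA : IsMoebius A (σ RatFunc.X)) (n : ℕ) : IsMoebius (A ^ n) ((σ ^ n) RatFunc.X) := by
  induction n with
  | zero => exact isMoebius_one
  | succ n ih =>
    rw [pow_succ, pow_succ']
    exact hA.mul ih

theorem IsMoebius.inv {A : GL (Fin 2) k} {σ : RatFunc k ≃ₐ[k] RatFunc k}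
    (hA : IsMoebius A (σ RatFunc.X)) : IsMoebius A⁻¹ (σ⁻¹ RatFunc.X) := by
  unfold IsMoebius at *
  have h := congrArg (σ⁻¹ : RatFunc k ≃ₐ[k] RatFunc k) hA
  have hX : (σ⁻¹ : RatFunc k ≃ₐ[k] RatFunc k) (σ RatFunc.X) = RatFunc.X := σ.symm_apply_apply _
  simp only [map_mul, map_add, RatFunc.algEquiv_C, hX] at h
  simp only [Matrix.coe_units_inv, Matrix.inv_def, Matrix.adjugate_fin_two, Matrix.smul_apply,
    Matrix.of_apply, Matrix.cons_val', Matrix.cons_val_zero, Matrix.cons_val_one,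
    Matrix.cons_val_fin_one, smul_eq_mul, map_mul, map_neg]
  linear_combination (-RatFunc.C (Ring.inverse A.val.det)) * h

theorem IsMoebius.eq_smul_one {A : GL (Fin 2) k} (hA : IsMoebius A RatFunc.X) :
    ∃ s : k, A.val = s • 1 := by
  have h : Polynomial.C (A 1 0) * Polynomial.X ^ 2 + Polynomial.C (A 1 1 - A 0 0) * Polynomial.X -
      Polynomial.C (A 0 1) = 0 := by
    apply RatFunc.algebraMap_injective k
    unfold IsMoebius at hA
    simp only [map_sub, map_add, map_mul, map_pow, RatFunc.algebraMap_C, RatFunc.algebraMap_X,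
      map_zero]
    linear_combination hA
  have h0 := congrArg (Polynomial.coeff · 0) h
  have h1 := congrArg (Polynomial.coeff · 1) h
  have h2 := congrArg (Polynomial.coeff · 2) h
  simp [Polynomial.coeff_X, Polynomial.coeff_C, -map_sub] at h0 h1 h2
  refine ⟨A 0 0, ?_⟩
  ext i j
  fin_cases i <;> fin_cases j <;> simp [h0, h2]
  linear_combination h1

theorem IsMoebius.eq_smul {A B : GL (Fin 2) k} {σ : RatFunc k ≃ₐ[k] RatFunc k}
    (hA : IsMoebius A (σ RatFunc.X)) (hB : IsMoebius B (σ RatFunc.X)) :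
    ∃ s : k, A.val = s • B.val := by
  have h := hA.mul hB.inv
  rw [mul_inv_cancel] at h
  obtain ⟨s, hs⟩ := h.eq_smul_one
  refine ⟨s, ?_⟩
  have : A.val = B.val * (B⁻¹ * A).val := by rw [← Units.val_mul, mul_inv_cancel_left]
  rw [this, hs, mul_smul_comm, mul_one]

/-- Every automorphism of `k(X)` over `k` is a Möbius transformation. -/
theorem exists_isMoebius (σ : RatFunc k ≃ₐ[k] RatFunc k) :
    ∃ A : GL (Fin 2) k, IsMoebius A (σ RatFunc.X) := by
  set y := σ RatFunc.X with hy
  have htop : IntermediateField.adjoin k {y} = ⊤ := by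
    have h := congrArg (IntermediateField.map σ.toAlgHom) (RatFunc.adjoin_X (K := k))
    rw [IntermediateField.adjoin_map, Set.image_singleton, ← AlgHom.fieldRange_eq_map] at h
    refine h.trans ?_
    rw [AlgHom.fieldRange_eq_top]
    exact σ.surjective
  -- The degree of `k(X)` over `k(y)` is the larger degree of numerator and denominator; it is `1`
  -- here because `y` generates `k(X)`.
  have hrank := RatFunc.finrank_eq_max_natDegree y
  rw [htop, IntermediateField.finrank_top] at hrank
  have hnum : y.num.natDegree ≤ 1 := by rw [hrank]; exact le_max_left _ _
  have hden : y.denom.natDegree ≤ 1 := by rw [hrank]; exact le_max_right _ _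
  obtain ⟨a, b, hab⟩ := Polynomial.exists_eq_X_add_C_of_natDegree_le_one hnum
  obtain ⟨c, d, hcd⟩ := Polynomial.exists_eq_X_add_C_of_natDegree_le_one hden
  have heq : (RatFunc.C c * RatFunc.X + RatFunc.C d) * y = RatFunc.C a * RatFunc.X + RatFunc.C b := by
    have h := RatFunc.num_div_denom y
    rw [div_eq_iff (RatFunc.algebraMap_ne_zero y.denom_ne_zero), hab, hcd] at h
    simp only [map_add, map_mul, RatFunc.algebraMap_C, RatFunc.algebraMap_X] at h
    rw [mul_comm, ← h]
  have hconst (s : k) : y ≠ RatFunc.C s := fun h => by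
    have : RatFunc.X = RatFunc.C s := σ.injective (by rw [← hy, h, RatFunc.algEquiv_C])
    have h2 : RatFunc.C 1 * RatFunc.X + RatFunc.C (-s) = 0 := by rw [this]; simp
    exact one_ne_zero (RatFunc.linear_eq_zero_iff.1 h2).1
  -- With vanishing determinant the fraction `y` would be a constant, against the injectivity of
  -- `σ`.
  have hdet : a * d - b * c ≠ 0 := by
    intro hdet
    have hdet' : RatFunc.C a * RatFunc.C d - RatFunc.C b * RatFunc.C c = 0 := by
      rw [← map_mul, ← map_mul, ← map_sub, hdet, map_zero]
    have hne : RatFunc.C c * RatFunc.X + RatFunc.C d ≠ 0 := by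
      have := RatFunc.algebraMap_ne_zero (K := k) y.denom_ne_zero
      rw [hcd] at this
      simpa using this
    have h1 : RatFunc.C c * y = RatFunc.C a := by
      refine mul_left_cancel₀ hne ?_
      linear_combination RatFunc.C c * heq - hdet'
    have h2 : RatFunc.C d * y = RatFunc.C b := by
      refine mul_left_cancel₀ hne ?_
      linear_combination RatFunc.C d * heq + RatFunc.X * hdet'
    by_cases hc : c = 0
    · by_cases hd : d = 0
      · exact hne (by simp [hc, hd])
      · refine hconst (d⁻¹ * b) ?_
        rw [map_mul, ← h2, ← mul_assoc, ← map_mul, inv_mul_cancel₀ hd, map_one, one_mul]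
    · refine hconst (c⁻¹ * a) ?_
      rw [map_mul, ← h1, ← mul_assoc, ← map_mul, inv_mul_cancel₀ hc, map_one, one_mul]
  refine ⟨Matrix.GeneralLinearGroup.mkOfDetNeZero !![a, b; c, d] ?_, ?_⟩
  · rwa [Matrix.det_fin_two_of]
  · simpa [IsMoebius, Matrix.GeneralLinearGroup.mkOfDetNeZero] using heq

/-- The nonabelian group `C₁₃ ⋊ C₃` does not act faithfully on `k(X)`. -/
theorem ratFunc_algEquiv_eq_one [CharZero k] (σ τ : RatFunc k ≃ₐ[k] RatFunc k) (h13 : σ ^ 13 = 1)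
    (h : σ * τ = τ * σ ^ 3) : σ = 1 := by
  obtain ⟨A, hA⟩ := exists_isMoebius σ
  obtain ⟨B, hB⟩ := exists_isMoebius τ
  have h13' := hA.pow 13
  rw [h13] at h13'
  obtain ⟨c, hc⟩ := h13'.eq_smul_one
  have hl := hA.mul hB
  rw [h] at hl
  -- `A ^ 3 * B` and `B * A` both represent `σ τ = τ σ³`, so they agree up to a scalar.
  obtain ⟨d, hd⟩ := (hB.mul (hA.pow 3)).eq_smul hl
  obtain ⟨s, hs⟩ := exists_eq_smul_one_of_conj_pow_three A.val B.val A.det.ne_zero B.det.ne_zero c d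
    (by simpa using hc) (by simpa using hd)
  have hs0 : s ≠ 0 := by
    rintro rfl
    apply A.det.ne_zero
    change A.val.det = 0
    simp [hs]
  unfold IsMoebius at hA
  rw [hs] at hA
  simp at hA
  have hX : σ RatFunc.X = RatFunc.X := by
    obtain h | h := hA
    · exact h
    · exact absurd h hs0
  refine AlgEquiv.coe_toAlgHom_injective (RatFunc.algHom_ext ?_)
  simpa using hX

/-! ### Unirational curves are rational -/

/-- A finitely generated subalgebra of `k(x₁, …, xₙ)` which is not reduced to constants
has a homomorphism to `k(X)` with a nonconstant value (restriction to a suitable line). -/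
theorem exists_algHom_ratFunc_ne_algebraMap {k : Type*} [Field k] [Infinite k] {n : ℕ} {L : Type*}
    [Field L] [Algebra k L] [Algebra (MvPolynomial (Fin n) k) L]
    [IsScalarTower k (MvPolynomial (Fin n) k) L] [IsFractionRing (MvPolynomial (Fin n) k) L]
    {R : Type*} [CommRing R] [Algebra k R] [Algebra.FiniteType k R] (e : R →ₐ[k] L) (r : R)
    (hr : ∀ c : k, e r ≠ algebraMap k L c) :
    ∃ θ : R →ₐ[k] RatFunc k, ∀ c : k, θ r ≠ algebraMap k (RatFunc k) c := by
  classical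
  obtain ⟨s, hs⟩ := (inferInstance : Algebra.FiniteType k R).out
  -- a common denominator
  obtain ⟨⟨h, hh⟩, hden⟩ := IsLocalization.exist_integer_multiples_of_finset
    (nonZeroDivisors (MvPolynomial (Fin n) k)) (s.image e)
  have hh0 : h ≠ 0 := nonZeroDivisors.ne_zero hh
  let A := Localization.Away h
  have hunit : IsUnit (Algebra.ofId (MvPolynomial (Fin n) k) L h) := by
    refine isUnit_iff_ne_zero.2 ?_
    rw [Algebra.ofId_apply, Ne, IsFractionRing.to_map_eq_zero_iff]
    exact hh0
  let toL : A →ₐ[MvPolynomial (Fin n) k] L :=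
    IsLocalization.Away.liftAlgHom (S := A) h (f := Algebra.ofId _ L) hunit
  let toL' : A →ₐ[k] L := toL.restrictScalars k
  have htoL (q : MvPolynomial (Fin n) k) : toL' (algebraMap _ A q) = algebraMap _ L q :=
    toL.commutes q
  have hinj : Function.Injective toL' := by
    refine (IsLocalization.lift_injective_iff (M := Submonoid.powers h) _).2 fun a b => ?_
    have hle : Submonoid.powers h ≤ nonZeroDivisors (MvPolynomial (Fin n) k) :=
      powers_le_nonZeroDivisors_of_noZeroDivisors hh0
    exact ⟨fun hab => congrArg _ (IsLocalization.injective A hle hab),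
      fun hab => congrArg _ (IsFractionRing.injective (MvPolynomial (Fin n) k) L hab)⟩
  have hrange : e.range ≤ toL'.range := by
    rw [← Algebra.map_top, ← hs, AlgHom.map_adjoin, Algebra.adjoin_le_iff]
    rintro _ ⟨x, hx, rfl⟩
    obtain ⟨p, hp⟩ := hden (e x) (Finset.mem_image_of_mem _ hx)
    refine ⟨IsLocalization.mk' A p ⟨h, Submonoid.mem_powers h⟩, ?_⟩
    have h1 : toL' (IsLocalization.mk' A p ⟨h, Submonoid.mem_powers h⟩) * algebraMap _ L h =
        algebraMap _ L p := by
      rw [← htoL, ← map_mul, IsLocalization.mk'_spec' A p ⟨h, Submonoid.mem_powers h⟩ |>.symm.trans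
        (mul_comm _ _) |>.symm, htoL]
    refine mul_right_cancel₀ hunit.ne_zero (h1.trans ?_)
    rw [hp, Algebra.smul_def, mul_comm]
    rfl
  let R' : R →ₐ[k] A := (AlgEquiv.ofInjective toL' hinj).symm.toAlgHom.comp
    (e.codRestrict toL'.range fun x => hrange ⟨x, rfl⟩)
  have hR' (x : R) : toL' (R' x) = e x :=
    congrArg Subtype.val ((AlgEquiv.ofInjective toL' hinj).apply_symm_apply
      (e.codRestrict toL'.range (fun x => hrange ⟨x, rfl⟩) x))
  obtain ⟨p, m, hpm⟩ : ∃ (p : MvPolynomial (Fin n) k) (m : ℕ),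
      R' r * algebraMap _ A h ^ m = algebraMap _ A p := by
    obtain ⟨m, p, hp⟩ := IsLocalization.Away.surj h (R' r)
    exact ⟨p, m, hp⟩
  -- the line
  obtain ⟨P, hP⟩ : ∃ P, MvPolynomial.eval P h ≠ 0 := by
    by_contra! hc
    exact hh0 (MvPolynomial.funext fun x => by simpa using hc x)
  -- The value of `e r = p / h ^ m` at `P`. As `e r` is not the constant `c`, some `Q` has `p - c h
  -- ^ m` nonzero; `h` itself may vanish at `Q`. The line runs through `P` at parameter `0` and `Q`
  -- at parameter `1`: a constant restriction `d` would equal `c` by evaluation at `0`, and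
  -- evaluation at `1` of the polynomial identity `d h ^ m = p` would contradict the choice of `Q`.
  let c := MvPolynomial.eval P p / MvPolynomial.eval P h ^ m
  have hne : p - MvPolynomial.C c * h ^ m ≠ 0 := by
    intro h0
    refine hr c ?_
    have h1 := congrArg toL' hpm
    rw [map_mul, map_pow, hR', htoL, htoL, sub_eq_zero.1 h0, map_mul, map_pow] at h1
    refine (mul_right_cancel₀ (pow_ne_zero m hunit.ne_zero) h1).trans ?_
    rw [IsScalarTower.algebraMap_apply k (MvPolynomial (Fin n) k) L, MvPolynomial.algebraMap_eq]
  obtain ⟨Q, hQ⟩ : ∃ Q, MvPolynomial.eval Q (p - MvPolynomial.C c * h ^ m) ≠ 0 := by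
    by_contra! hc
    exact hne (MvPolynomial.funext fun x => by rw [hc x, map_zero])
  let ψ₀ : MvPolynomial (Fin n) k →ₐ[k] Polynomial k :=
    MvPolynomial.aeval fun i => Polynomial.C (P i) + Polynomial.X * Polynomial.C (Q i - P i)
  have heval (t : k) (q : MvPolynomial (Fin n) k) : (ψ₀ q).eval t =
      MvPolynomial.eval (fun i => P i + t * (Q i - P i)) q := by
    induction q using MvPolynomial.induction_on with
    | C a => simp [ψ₀]
    | add p q hp hq => simp [hp, hq]
    | mul_X p i hp => simp [hp]; simp [ψ₀]
  have heval0 (q) : (ψ₀ q).eval 0 = MvPolynomial.eval P q := by simp [heval]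
  have heval1 (q) : (ψ₀ q).eval 1 = MvPolynomial.eval Q q := by simp [heval]
  let ψ : MvPolynomial (Fin n) k →ₐ[k] RatFunc k :=
    (IsScalarTower.toAlgHom k (Polynomial k) (RatFunc k)).comp ψ₀
  have hψ : IsUnit (ψ h) := by
    refine isUnit_iff_ne_zero.2 (RatFunc.algebraMap_ne_zero fun h0 => hP ?_)
    rw [← heval0]
    exact (congrArg (Polynomial.eval 0) h0).trans Polynomial.eval_zero
  let θA : A →ₐ[k] RatFunc k := IsLocalization.Away.liftAlgHom (S := A) h (f := ψ) hψ
  have hθA (q : MvPolynomial (Fin n) k) : θA (algebraMap _ A q) = ψ q :=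
    IsLocalization.Away.lift_eq (S := A) h hψ q
  refine ⟨θA.comp R', fun d hd => ?_⟩
  have h1 := congrArg θA hpm
  rw [map_mul, map_pow, hθA, hθA, show θA (R' r) = _ from hd] at h1
  have h2 : Polynomial.C d * ψ₀ h ^ m = ψ₀ p := by
    apply RatFunc.algebraMap_injective k
    rw [map_mul, map_pow, RatFunc.algebraMap_C, ← RatFunc.algebraMap_eq_C]
    exact h1
  have h3 := congrArg (Polynomial.eval 0) h2
  have h4 := congrArg (Polynomial.eval 1) h2
  simp only [Polynomial.eval_mul, Polynomial.eval_C, Polynomial.eval_pow, heval0, heval1] at h3 h4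
  have hdc : d = c := eq_div_of_mul_eq (pow_ne_zero m hP) h3
  refine hQ ?_
  rw [map_sub, map_mul, map_pow, MvPolynomial.eval_C, ← hdc, h4, sub_self]

/-- A finitely generated domain of dimension at most one over an algebraically closed field
with a homomorphism to a field having a nonconstant value injects into this field. -/
theorem injective_of_ringKrullDim_le_one {k : Type*} [Field k] [IsAlgClosed k] {R F : Type*}
    [CommRing R] [IsDomain R] [Algebra k R] [Algebra.FiniteType k R] [Field F] [Algebra k F]
    (hdim : ringKrullDim R ≤ 1) (θ : R →ₐ[k] F) (r : R) (hr : ∀ c : k, θ r ≠ algebraMap k F c) :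
    Function.Injective θ := by
  have hR : Ring.KrullDimLE 1 R := Ring.krullDimLE_iff.2 (by exact_mod_cast hdim)
  have : (⊥ : Ideal R).IsPrime := Ideal.isPrime_bot
  rw [RingHom.injective_iff_ker_eq_bot]
  by_contra hne
  -- In dimension at most one a nonzero prime is maximal. By the Nullstellensatz the quotient is
  -- then `k`, making every value of `θ` constant.
  have hmax : (RingHom.ker θ).IsMaximal :=
    Ring.krullDimLE_one_iff_of_isPrime_bot.1 hR _ hne (RingHom.ker_isPrime _)
  let := Ideal.Quotient.field (RingHom.ker θ)
  have : Module.Finite k (R ⧸ RingHom.ker θ) := finite_of_finite_type_of_isJacobsonRing k _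
  have : Algebra.IsIntegral k (R ⧸ RingHom.ker θ) := Algebra.IsIntegral.of_finite k _
  obtain ⟨c, hc⟩ := (IsAlgClosed.algebraMap_bijective_of_isIntegral (k := k)
    (K := R ⧸ RingHom.ker θ)).2 (Ideal.Quotient.mk _ r)
  refine hr c ?_
  have h : Ideal.Quotient.mk (RingHom.ker θ) (r - algebraMap k R c) = 0 := by
    rw [map_sub, ← hc, sub_eq_zero]
    rfl
  rw [Ideal.Quotient.eq_zero_iff_mem, RingHom.mem_ker, map_sub, θ.commutes, sub_eq_zero] at h
  exact h

/-- If `R` has a nonconstant element, restriction to a line is injective on `R` because of its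
dimension; it extends to an embedding of `K` into `k(X)`, to whose image Lüroth's theorem applies.
-/
theorem exists_algEquiv_ratFunc {k : Type*} [Field k] [IsAlgClosed k] {n : ℕ} {L : Type*}
    [Field L] [Algebra k L] [Algebra (MvPolynomial (Fin n) k) L]
    [IsScalarTower k (MvPolynomial (Fin n) k) L] [IsFractionRing (MvPolynomial (Fin n) k) L]
    {R K : Type*} [CommRing R] [IsDomain R] [Algebra k R] [Algebra.FiniteType k R]
    (hdim : ringKrullDim R ≤ 1) [Field K] [Algebra R K] [Algebra k K] [IsScalarTower k R K]
    [IsFractionRing R K] (e : K →ₐ[k] L) :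
    Function.Surjective (algebraMap k K) ∨ Nonempty (RatFunc k ≃ₐ[k] K) := by
  have : Infinite k := IsAlgClosed.instInfinite
  by_cases hcon : ∀ r : R, ∃ c : k, algebraMap R K r = algebraMap k K c
  · left
    intro x
    obtain ⟨a, b, hb, rfl⟩ := IsFractionRing.div_surjective (A := R) x
    obtain ⟨c, hc⟩ := hcon a
    obtain ⟨d, hd⟩ := hcon b
    exact ⟨c / d, by rw [map_div₀, hc, hd]⟩
  · right
    push Not at hcon
    obtain ⟨r, hr⟩ := hcon
    obtain ⟨θ, hθ⟩ := exists_algHom_ratFunc_ne_algebraMap (n := n)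
      (e.comp (IsScalarTower.toAlgHom k R K)) r (fun c hc => hr c (e.injective (by simpa using hc)))
    have hinj := injective_of_ringKrullDim_le_one hdim θ r hθ
    let Θ : K →ₐ[k] RatFunc k := IsFractionRing.liftAlgHom (K := K) (g := θ) hinj
    have hΘ : Θ.fieldRange ≠ ⊥ := by
      intro hbot
      have : Θ (algebraMap R K r) ∈ Θ.fieldRange := ⟨_, rfl⟩
      rw [hbot, IntermediateField.mem_bot] at this
      obtain ⟨c, hc⟩ := this
      refine hθ c ?_
      rw [hc]
      simp [Θ]
    exact ⟨(RatFunc.Luroth.algEquiv hΘ).trans (AlgEquiv.ofInjectiveField Θ).symm⟩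

theorem algEquiv_eq_one_of_ringKrullDim_le_one {k : Type*} [Field k] [IsAlgClosed k] [CharZero k]
    {n : ℕ} {L : Type*} [Field L] [Algebra k L] [Algebra (MvPolynomial (Fin n) k) L]
    [IsScalarTower k (MvPolynomial (Fin n) k) L] [IsFractionRing (MvPolynomial (Fin n) k) L]
    {R K : Type*} [CommRing R] [IsDomain R] [Algebra k R] [Algebra.FiniteType k R]
    (hdim : ringKrullDim R ≤ 1) [Field K] [Algebra R K] [Algebra k K] [IsScalarTower k R K]
    [IsFractionRing R K] (e : K →ₐ[k] L) (σ τ : K ≃ₐ[k] K) (h13 : σ ^ 13 = 1)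
    (h : σ * τ = τ * σ ^ 3) : σ = 1 := by
  obtain hs | ⟨⟨φ⟩⟩ := exists_algEquiv_ratFunc (n := n) hdim e
  · ext x
    obtain ⟨c, rfl⟩ := hs x
    simp
  · let Φ : (K ≃ₐ[k] K) ≃* (RatFunc k ≃ₐ[k] RatFunc k) := AlgEquiv.autCongr φ.symm
    apply Φ.injective
    rw [map_one]
    refine ratFunc_algEquiv_eq_one (Φ σ) (Φ τ) ?_ ?_
    · rw [← map_pow, h13, map_one]
    · rw [← map_mul, h, map_mul, map_pow]

/-! ### The function field of a complex variety -/

instance isDominant_fromSpecStalk_genericPoint (Y : Scheme.{0}) [IrreducibleSpace Y] :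
    IsDominant (Y.fromSpecStalk (genericPoint Y)) := by
  refine ⟨?_⟩
  rw [DenseRange, Scheme.range_fromSpecStalk]
  refine Dense.mono (s₁ := {genericPoint Y}) ?_ ?_
  · rintro _ rfl
    exact specializes_rfl
  · exact dense_iff_closure_eq.2 (genericPoint_spec Y)

theorem isDominant_fromSpecStalkOfMem_genericPoint {Y : Scheme.{0}} [IsIntegral Y] (U : Y.Opens)
    (hU : genericPoint Y ∈ U) : IsDominant (U.fromSpecStalkOfMem (genericPoint Y) hU) := by
  have : Nonempty U := ⟨⟨_, hU⟩⟩
  refine ⟨Dense.mono (s₁ := {genericPoint U}) ?_ (dense_iff_closure_eq.2 (genericPoint_spec U))⟩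
  rintro _ rfl
  obtain ⟨p, hp⟩ : genericPoint Y ∈ Set.range (Y.fromSpecStalk (genericPoint Y)) := by
    rw [Scheme.range_fromSpecStalk]
    exact specializes_rfl
  refine ⟨p, U.ι.injective ?_⟩
  rw [genericPoint_eq_of_isOpenImmersion U.ι, ← Scheme.Hom.comp_apply,
    Scheme.Opens.fromSpecStalkOfMem_ι, hp]

/-- The spectrum of a field has one point; dominance forces its image to be the generic point, and
`s` is the induced map from the stalk there. -/
theorem exists_specMap_comp_fromSpecStalk {Y : Scheme.{0}} [IrreducibleSpace Y] {F : CommRingCat.{0}}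
    (hF : IsField F) (f : Spec F ⟶ Y) [IsDominant f] :
    ∃ s : Y.functionField ⟶ F, Spec.map s ≫ Y.fromSpecStalk (genericPoint Y) = f := by
  let := hF.toField
  have hpt : f (IsLocalRing.closedPoint F) = genericPoint Y := by
    have hsub : Subsingleton (Spec F) := inferInstanceAs (Subsingleton (PrimeSpectrum F))
    refine IsGenericPoint.eq ?_ (genericPoint_spec Y)
    rw [IsGenericPoint, ← dense_iff_closure_eq]
    refine Dense.mono ?_ f.denseRange
    rintro _ ⟨x, rfl⟩
    rw [Set.mem_singleton_iff, Subsingleton.elim x (IsLocalRing.closedPoint F)]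
  have h := Scheme.Spec_stalkClosedPointTo_fromSpecStalk f
  have hs : genericPoint Y ⤳ f (IsLocalRing.closedPoint F) := hpt ▸ specializes_rfl
  have hs' : f (IsLocalRing.closedPoint F) ⤳ genericPoint Y := hpt ▸ specializes_rfl
  refine ⟨Y.presheaf.stalkSpecializes hs' ≫ Scheme.stalkClosedPointTo f, ?_⟩
  rw [Spec.map_comp, Category.assoc, Scheme.SpecMap_stalkSpecializes_fromSpecStalk, h]

/-- The structure morphism from `ℂ` to the function field. -/
def functionFieldStruct (X : Over SpecC) [IrreducibleSpace X.left] :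
    CommRingCat.of ℂ ⟶ X.left.functionField :=
  Spec.preimage (X.left.fromSpecStalk (genericPoint X.left) ≫ X.hom)

theorem specMap_functionFieldStruct (X : Over SpecC) [IrreducibleSpace X.left] :
    Spec.map (functionFieldStruct X) = X.left.fromSpecStalk (genericPoint X.left) ≫ X.hom :=
  Spec.map_preimage _

abbrev functionFieldAlgebra (X : Over SpecC) [IrreducibleSpace X.left] :
    Algebra ℂ X.left.functionField :=
  (functionFieldStruct X).hom.toAlgebra

attribute [local instance] functionFieldAlgebra

theorem functionField_isField (Y : Scheme.{0}) [IsIntegral Y] : IsField Y.functionField :=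
  Field.toIsField Y.functionField

/-- Polynomials as rational functions on the affine space. -/
abbrev affineSpaceAlgebra (n : ℕ) :
    Algebra (MvPolynomial (Fin n) ℂ) (affineSpace n).left.functionField :=
  @instAlgebraCarrierFunctionFieldSpec (CommRingCat.of (MvPolynomial (Fin n) ℂ))
    (inferInstanceAs (IsDomain (MvPolynomial (Fin n) ℂ)))

attribute [local instance] affineSpaceAlgebra

instance isFractionRing_affineSpace (n : ℕ) :
    IsFractionRing (MvPolynomial (Fin n) ℂ) (affineSpace n).left.functionField :=
  @functionField_isFractionRing_of_affine (CommRingCat.of (MvPolynomial (Fin n) ℂ))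
    (inferInstanceAs (IsDomain (MvPolynomial (Fin n) ℂ)))

instance isScalarTower_affineSpace (n : ℕ) :
    IsScalarTower ℂ (MvPolynomial (Fin n) ℂ) (affineSpace n).left.functionField := by
  refine IsScalarTower.of_algebraMap_eq' ?_
  let t : CommRingCat.of (MvPolynomial (Fin n) ℂ) ⟶ (affineSpace n).left.functionField :=
    StructureSheaf.toStalk (CommRingCat.of (MvPolynomial (Fin n) ℂ)) _
  have ht : Spec.map t =
      (affineSpace n).left.fromSpecStalk (genericPoint (affineSpace n).left) :=
    (Spec.fromSpecStalk_eq' _ _).symm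
  have h : functionFieldStruct (affineSpace n) =
      CommRingCat.ofHom (algebraMap ℂ (MvPolynomial (Fin n) ℂ)) ≫ t := by
    apply Spec.map_injective
    rw [specMap_functionFieldStruct, Spec.map_comp, ht]
    rfl
  exact congrArg CommRingCat.Hom.hom h

/-- A dominant rational map over `ℂ` from an affine space embeds function fields. -/
theorem exists_algHom_functionField {X : Over SpecC} [IsIntegral X.left] {n : ℕ}
    (f : (affineSpace n).left ⤏ X.left) (hdom : f.IsDominant)
    (hover : f.compHom X.hom = (affineSpace n).hom.toRationalMap) :
    Nonempty (X.left.functionField →ₐ[ℂ] (affineSpace n).left.functionField) := by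
  have hd : IsDominant f.fromFunctionField := by
    obtain ⟨f, rfl⟩ := f.exists_rep
    rw [Scheme.PartialMap.isDominant_toRationalMap_iff] at hdom
    rw [Scheme.RationalMap.fromFunctionField_toRationalMap, Scheme.PartialMap.fromFunctionField,
      Scheme.PartialMap.fromSpecStalkOfMem]
    have := isDominant_fromSpecStalkOfMem_genericPoint f.domain
      ((genericPoint_specializes _).mem_open f.domain.2 f.dense_domain.nonempty.choose_spec)
    infer_instance
  have hf : f.fromFunctionField ≫ X.hom = Spec.map (functionFieldStruct (affineSpace n)) := by
    rw [specMap_functionFieldStruct]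
    obtain ⟨f, rfl⟩ := f.exists_rep
    simpa [Scheme.RationalMap.fromFunctionField_toRationalMap] using!
      congr(Scheme.RationalMap.fromFunctionField $hover)
  obtain ⟨s, hs⟩ := exists_specMap_comp_fromSpecStalk (functionField_isField _) f.fromFunctionField
  have hcomm : functionFieldStruct X ≫ s = functionFieldStruct (affineSpace n) := by
    apply Spec.map_injective
    rw [Spec.map_comp, specMap_functionFieldStruct, ← hf, ← hs, Category.assoc]
  exact ⟨{ s.hom with
    commutes' := fun c => congrArg (fun φ : CommRingCat.of ℂ ⟶ _ => φ.hom c) hcomm }⟩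

theorem actionMap_mul {G : Type*} [Group G] {X : Over SpecC} (α : G →* Aut X) (g h : G) :
    actionMap α (g * h) = actionMap α h ≫ actionMap α g := by
  simp only [actionMap, map_mul]
  rfl

theorem actionMap_one {G : Type*} [Group G] {X : Over SpecC} (α : G →* Aut X) :
    actionMap α 1 = 𝟙 _ := by
  simp only [actionMap, map_one]
  rfl

theorem actionMap_comp_hom {G : Type*} [Group G] {X : Over SpecC} (α : G →* Aut X) (g : G) :
    actionMap α g ≫ X.hom = X.hom :=
  Over.w (α g : X ≅ X).hom

/-- An action on a variety induces an action on its function field. -/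
theorem exists_functionField_action {G : Type*} [Group G] {X : Over SpecC} [IsIntegral X.left]
    (α : G →* Aut X) :
    ∃ T : G →* (X.left.functionField ≃ₐ[ℂ] X.left.functionField), ∀ g,
      Spec.map (CommRingCat.ofHom ((T g : X.left.functionField →ₐ[ℂ] X.left.functionField) :
        X.left.functionField →+* X.left.functionField)) ≫
          X.left.fromSpecStalk (genericPoint X.left) =
        X.left.fromSpecStalk (genericPoint X.left) ≫ actionMap α g⁻¹ := by
  set ι := X.left.fromSpecStalk (genericPoint X.left) with hι
  have hex (g : G) : ∃ s : X.left.functionField →ₐ[ℂ] X.left.functionField,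
      Spec.map (CommRingCat.ofHom (s : X.left.functionField →+* X.left.functionField)) ≫ ι =
        ι ≫ actionMap α g := by
    obtain ⟨s, hs⟩ := exists_specMap_comp_fromSpecStalk (functionField_isField _)
      (ι ≫ actionMap α g)
    have hcomm : functionFieldStruct X ≫ s = functionFieldStruct X := by
      apply Spec.map_injective
      rw [Spec.map_comp, specMap_functionFieldStruct, ← hι, reassoc_of% hs, actionMap_comp_hom]
    exact ⟨{ s.hom with
      commutes' := fun c => congrArg (fun φ : CommRingCat.of ℂ ⟶ _ => φ.hom c) hcomm }, hs⟩
  choose S hS using hex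
  have huniq (s t : X.left.functionField →ₐ[ℂ] X.left.functionField)
      (h : Spec.map (CommRingCat.ofHom (s : X.left.functionField →+* X.left.functionField)) ≫ ι =
        Spec.map (CommRingCat.ofHom (t : X.left.functionField →+* X.left.functionField)) ≫ ι) :
      s = t := by
    have h1 := Spec.map_injective ((cancel_mono ι).1 h)
    exact AlgHom.coe_ringHom_injective (congrArg CommRingCat.Hom.hom h1)
  let T₀ : G →* (X.left.functionField →ₐ[ℂ] X.left.functionField) :=
    -- Pulling back functions reverses products, and the inverse restores the order.
    { toFun := fun g => S g⁻¹
      map_one' := by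
        apply huniq
        rw [hS, inv_one, actionMap_one, Category.comp_id]
        exact (Category.id_comp ι).symm.trans (by rw [← Spec.map_id]; rfl)
      map_mul' := fun g h => by
        apply huniq
        rw [hS, mul_inv_rev, actionMap_mul, ← Category.assoc, ← hS g⁻¹, Category.assoc, ← hS h⁻¹,
          ← Category.assoc, ← Spec.map_comp]
        rfl }
  exact ⟨(AlgEquiv.algHomUnitsEquiv ℂ _).toMonoidHom.comp T₀.toHomUnits, fun g => hS g⁻¹⟩

/-- The function field of a variety is the fraction field of a finitely generated algebra
of no larger dimension. -/
theorem exists_isFractionRing_functionField {X : Over SpecC} (hX : IsVariety X)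
    [IsIntegral X.left] :
    ∃ (R : Type) (_ : CommRing R) (_ : IsDomain R) (_ : Algebra ℂ R)
      (_ : Algebra R X.left.functionField), Algebra.FiniteType ℂ R ∧
      IsScalarTower ℂ R X.left.functionField ∧ IsFractionRing R X.left.functionField ∧
      ringKrullDim R ≤ topologicalKrullDim X.left := by
  have := hX.locallyOfFiniteType
  obtain ⟨_, ⟨U, hU, rfl⟩, hxU, -⟩ := X.left.isBasis_affineOpens.exists_subset_of_mem_open
    (Set.mem_univ (genericPoint X.left)) isOpen_univ
  have hne : Nonempty U := ⟨⟨_, hxU⟩⟩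
  replace hU : IsAffineOpen U := hU
  have := hU.isOpenImmersion_fromSpec
  let φ : CommRingCat.of ℂ ⟶ Γ(X.left, U) := Spec.preimage (hU.fromSpec ≫ X.hom)
  have hφ : Spec.map φ = hU.fromSpec ≫ X.hom := Spec.map_preimage _
  have hft : LocallyOfFiniteType (Spec.map φ) := by rw [hφ]; infer_instance
  rw [HasRingHomProperty.Spec_iff (P := @LocallyOfFiniteType)] at hft
  let := φ.hom.toAlgebra
  refine ⟨Γ(X.left, U), inferInstance, inferInstance, φ.hom.toAlgebra, inferInstance, hft, ?_,
    functionField_isFractionRing_of_isAffineOpen X.left U hU, ?_⟩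
  · refine IsScalarTower.of_algebraMap_eq' ?_
    have h : functionFieldStruct X = φ ≫ X.left.germToFunctionField U := by
      apply Spec.map_injective
      rw [specMap_functionFieldStruct, Spec.map_comp, hφ,
        ← hU.fromSpecStalk_eq_fromSpecStalk hxU, IsAffineOpen.fromSpecStalk, Category.assoc]
    exact congrArg CommRingCat.Hom.hom h
  · rw [← PrimeSpectrum.topologicalKrullDim_eq_ringKrullDim]
    exact hU.fromSpec.isOpenEmbedding.isInducing.topologicalKrullDim_le

/-! ### The lower bound -/

theorem two_le_topologicalKrullDim {X : Over SpecC} (hX : IsVariety X) (α : G39 →* Aut X)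
    (hα : Function.Injective α) (hlin : IsLinearizable α) : 2 ≤ topologicalKrullDim X.left := by
  have := hX.isIntegral
  have := hX.isSeparated
  obtain ⟨n, -, f, hdom, hover, -⟩ := hlin
  by_contra hlt
  have hdim : topologicalKrullDim X.left ≤ 1 := by
    rw [not_le] at hlt
    exact ENat.WithBot.lt_add_one_iff.1 (by simpa [one_add_one_eq_two] using hlt)
  obtain ⟨e⟩ := exists_algHom_functionField f hdom hover
  obtain ⟨T, hT⟩ := exists_functionField_action α
  obtain ⟨R, _, _, _, _, _, _, _, hR⟩ := exists_isFractionRing_functionField hX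
  have hσ : T genA = 1 := by
    -- The inverse of `genB` is used because `b a b⁻¹ = a³` reads `a b⁻¹ = b⁻¹ a³`.
    refine algEquiv_eq_one_of_ringKrullDim_le_one (n := n) (hR.trans hdim) e (T genA) (T genB⁻¹) ?_ ?_
    · rw [← map_pow, genA_pow, map_one]
    · rw [← map_pow, ← map_mul, ← map_mul,
        show genA * genB⁻¹ = genB⁻¹ * genA ^ 3 by rw [← genB_conj_genA]; group]
  have h := hT genA
  rw [hσ] at h
  have h1 : actionMap α genA⁻¹ = 𝟙 _ := by
    -- An automorphism trivial on the function field agrees with the identity at the dense generic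
    -- point, hence everywhere by separatedness.
    refine ext_of_isDominant_of_isSeparated X.hom ?_
      (X.left.fromSpecStalk (genericPoint X.left)) ?_
    · rw [actionMap_comp_hom, Category.id_comp]
    · rw [← h, Category.comp_id]
      exact (by rw [← Spec.map_id]; rfl : _ = 𝟙 _ ≫ _).trans (Category.id_comp _)
  have h2 : α genA⁻¹ = 1 := by
    apply Iso.ext
    apply Over.OverMorphism.ext
    exact h1
  rw [← map_one α] at h2
  exact absurd (hα h2) (by decide)

/-! ### Rational maps and open immersions -/

theorem rationalMap_compHom_injective {X Y Z : Scheme.{0}} (j : Y ⟶ Z) [Mono j]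
    {f g : X ⤏ Y} (h : f.compHom j = g.compHom j) : f = g := by
  obtain ⟨f, rfl⟩ := f.exists_rep
  obtain ⟨g, rfl⟩ := g.exists_rep
  rw [← Scheme.RationalMap.compHom_toRationalMap, ← Scheme.RationalMap.compHom_toRationalMap,
    Scheme.PartialMap.toRationalMap_eq_iff] at h
  obtain ⟨W, hW, hf, hg, e⟩ := h
  refine Scheme.PartialMap.toRationalMap_eq_iff.2 ⟨W, hW, hf, hg, (cancel_mono j).1 ?_⟩
  simp only [Scheme.PartialMap.restrict_hom] at e ⊢
  simpa using! e

theorem rationalMap_compHom_comp {X Y Z W : Scheme.{0}} [IrreducibleSpace X] [IrreducibleSpace Y]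
    [Nonempty Z] (f : X ⤏ Y) [f.IsDominant] (g : Y ⤏ Z) [g.IsDominant] (h : Z ⟶ W) :
    f.comp (g.compHom h) = (f.comp g).compHom h := by
  rw [← Scheme.RationalMap.comp_toRationalMap, ← Scheme.RationalMap.comp_toRationalMap,
    Scheme.RationalMap.comp_assoc]

theorem rationalMap_compHom_compHom {X Y Z W : Scheme.{0}} (f : X ⤏ Y) (g : Y ⟶ Z) (h : Z ⟶ W) :
    (f.compHom g).compHom h = f.compHom (g ≫ h) := by
  obtain ⟨f, rfl⟩ := f.exists_rep
  rw [← Scheme.RationalMap.compHom_toRationalMap, ← Scheme.RationalMap.compHom_toRationalMap,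
    ← Scheme.RationalMap.compHom_toRationalMap]
  congr 1

/-- A dominant open immersion has an inverse rational map. -/
theorem exists_rationalMap_compHom_eq_id {U V : Scheme.{0}} (j : U ⟶ V) [IsOpenImmersion j]
    [IsDominant j] : ∃ r : V ⤏ U, r.IsDominant ∧ r.compHom j = Scheme.RationalMap.id V := by
  let r : V.PartialMap U := ⟨j.opensRange, j.denseRange, j.isoOpensRange.inv⟩
  refine ⟨r.toRationalMap, ?_, ?_⟩
  · rw [Scheme.PartialMap.isDominant_toRationalMap_iff]
    exact inferInstanceAs (IsDominant j.isoOpensRange.inv)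
  · rw [← Scheme.RationalMap.compHom_toRationalMap, Scheme.PartialMap.toRationalMap_eq_iff]
    refine ⟨j.opensRange, j.denseRange, le_rfl, le_top, ?_⟩
    change V.homOfLE le_rfl ≫ j.isoOpensRange.inv ≫ j = V.homOfLE le_top ≫ V.topIso.hom ≫ 𝟙 V
    rw [Scheme.Hom.isoOpensRange_inv_comp]
    simp

/-! ### Affine schemes with a group action -/

/-- The spectrum of a `ℂ`-algebra as a scheme over `ℂ`. -/
def specOver (R : Type) [CommRing R] [Algebra ℂ R] : Over SpecC :=
  Over.mk (Spec.map (CommRingCat.ofHom (algebraMap ℂ R)))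

theorem isVariety_specOver (R : Type) [CommRing R] [IsDomain R] [Algebra ℂ R]
    [hR : Algebra.FiniteType ℂ R] : IsVariety (specOver R) where
  isIntegral := inferInstanceAs (IsIntegral (Spec (CommRingCat.of R)))
  isSeparated := inferInstanceAs
    (IsSeparated (Spec.map (CommRingCat.ofHom (algebraMap ℂ R))))
  locallyOfFiniteType := by
    change LocallyOfFiniteType (Spec.map (CommRingCat.ofHom (algebraMap ℂ R)))
    rw [HasRingHomProperty.Spec_iff (P := @LocallyOfFiniteType)]
    exact RingHom.finiteType_algebraMap.2 hR
  quasiCompact := inferInstanceAs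
    (QuasiCompact (Spec.map (CommRingCat.ofHom (algebraMap ℂ R))))

/-- The morphism of spectra induced by a homomorphism of algebras. -/
def specOverMap {R S : Type} [CommRing R] [Algebra ℂ R] [CommRing S] [Algebra ℂ S]
    (φ : R →ₐ[ℂ] S) : specOver S ⟶ specOver R :=
  Over.homMk (Spec.map (CommRingCat.ofHom φ.toRingHom)) (by
    dsimp [specOver]
    rw [← Spec.map_comp, ← CommRingCat.ofHom_comp]
    congr 2
    exact φ.comp_algebraMap)

section
variable {R S T : Type} [CommRing R] [Algebra ℂ R] [CommRing S] [Algebra ℂ S] [CommRing T]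
  [Algebra ℂ T]

theorem specOverMap_id : specOverMap (AlgHom.id ℂ R) = 𝟙 (specOver R) := by
  ext1
  exact Spec.map_id _

theorem specOverMap_comp (φ : R →ₐ[ℂ] S) (ψ : S →ₐ[ℂ] T) :
    specOverMap (ψ.comp φ) = specOverMap ψ ≫ specOverMap φ := by
  ext1
  change Spec.map _ = Spec.map _ ≫ Spec.map _
  rw [← Spec.map_comp]
  rfl

theorem specOverMap_injective {φ ψ : R →ₐ[ℂ] S} (h : specOverMap φ = specOverMap ψ) : φ = ψ := by
  have h1 : Spec.map (CommRingCat.ofHom φ.toRingHom) = Spec.map (CommRingCat.ofHom ψ.toRingHom) :=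
    congrArg (fun f => f.left) h
  exact AlgHom.coe_ringHom_injective (congrArg CommRingCat.Hom.hom (Spec.map_injective h1))

theorem isDominant_specOverMap {φ : R →ₐ[ℂ] S} (hφ : Function.Injective φ) :
    IsDominant (specOverMap φ).left := by
  constructor
  refine (PrimeSpectrum.denseRange_comap_iff_ker_le_nilRadical φ.toRingHom).2 ?_
  rw [(RingHom.injective_iff_ker_eq_bot φ.toRingHom).1 hφ]
  exact bot_le

end

/-- The action on the spectrum given by an action on an algebra from the right. -/
def specAction {G : Type*} [Group G] {R : Type} [CommRing R] [Algebra ℂ R] (F : G → R →ₐ[ℂ] R)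
    (h1 : F 1 = AlgHom.id ℂ R) (hmul : ∀ g h, F (g * h) = (F h).comp (F g)) :
    G →* Aut (specOver R) where
  toFun g :=
    { hom := specOverMap (F g)
      inv := specOverMap (F g⁻¹)
      hom_inv_id := by rw [← specOverMap_comp, ← hmul, inv_mul_cancel, h1, specOverMap_id]
      inv_hom_id := by rw [← specOverMap_comp, ← hmul, mul_inv_cancel, h1, specOverMap_id] }
  map_one' := by
    ext1
    exact (congrArg specOverMap h1).trans specOverMap_id
  map_mul' g h := by
    ext1
    exact (congrArg specOverMap (hmul g h)).trans (specOverMap_comp _ _)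

/-- The rational map goes backwards along the open immersion `Spec S → ℂⁿ` and then down to `Spec
R`. The maps `D g` lift the linear action to `Spec S`, which makes both halves equivariant; for the
first half this is checked after composing with the open immersion, a monomorphism. -/
theorem isLinearizable_specAction {G : Type*} [Group G] {R S : Type} [CommRing R] [IsDomain R]
    [Algebra ℂ R] [CommRing S] [IsDomain S] [Algebra ℂ S] (F : G → R →ₐ[ℂ] R)
    (h1 : F 1 = AlgHom.id ℂ R) (hmul : ∀ g h, F (g * h) = (F h).comp (F g))
    {n : ℕ} (ρ : G →* GL (Fin n) ℂ) (D : G → S →ₐ[ℂ] S) (i : MvPolynomial (Fin n) ℂ →ₐ[ℂ] S)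
    (hi : Function.Injective i) (hopen : IsOpenImmersion (specOverMap i).left)
    (q : R →ₐ[ℂ] S) (hq : Function.Injective q)
    (hDi : ∀ g, (D g).comp i = i.comp (linSubst (ρ g).val))
    (hDq : ∀ g, (D g).comp q = q.comp (F g)) : IsLinearizable (specAction F h1 hmul) := by
  have := isDominant_specOverMap hi
  have := isDominant_specOverMap hq
  have : IsIntegral (specOver R).left := inferInstanceAs (IsIntegral (Spec (CommRingCat.of R)))
  have : IsIntegral (specOver S).left := inferInstanceAs (IsIntegral (Spec (CommRingCat.of S)))
  let j : (specOver S).left ⟶ (affineSpace n).left := (specOverMap i).left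
  have : IsOpenImmersion j := hopen
  have : IsDominant j := isDominant_specOverMap hi
  have hj : j ≫ (affineSpace n).hom = (specOver S).hom := Over.w (specOverMap i)
  obtain ⟨r, hr, hrj⟩ := exists_rationalMap_compHom_eq_id j
  refine ⟨n, ρ, r.compHom (specOverMap q).left, ?_, ?_, fun g => ?_⟩
  · rw [← Scheme.RationalMap.comp_toRationalMap]
    infer_instance
  · rw [rationalMap_compHom_compHom, Over.w, ← hj, ← rationalMap_compHom_compHom, hrj,
      Scheme.RationalMap.id_compHom]
  · have hA : (specOverMap (D g)).left ≫ j = j ≫ actionMap ((linAut n).comp ρ) g := by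
      have h := congrArg specOverMap (hDi g)
      rw [specOverMap_comp, specOverMap_comp] at h
      exact congrArg (fun f => f.left) h
    have hB : (specOverMap (D g)).left ≫ (specOverMap q).left =
        (specOverMap q).left ≫ actionMap (specAction F h1 hmul) g := by
      have h := congrArg specOverMap (hDq g)
      rw [specOverMap_comp, specOverMap_comp] at h
      exact congrArg (fun f => f.left) h
    have hAr : (actionMap ((linAut n).comp ρ) g).toRationalMap.comp r =
        r.compHom (specOverMap (D g)).left := by
      apply rationalMap_compHom_injective j
      rw [← rationalMap_compHom_comp, hrj, Scheme.RationalMap.comp_id,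
        rationalMap_compHom_compHom, hA, ← rationalMap_compHom_compHom, hrj,
        Scheme.RationalMap.id_compHom]
    rw [rationalMap_compHom_comp, hAr, rationalMap_compHom_compHom, rationalMap_compHom_compHom,
      hB]

/-! ### The upper bound: a torus with an action of `C₁₃ ⋊ C₃` -/

theorem G39_induction {p : G39 → Prop} (one : p 1) (mul : ∀ g h, p g → p h → p (g * h))
    (a : p genA) (b : p genB) (g : G39) : p g := by
  have hpow (x : G39) (hx : p x) (n : ℕ) : p (x ^ n) := by
    induction n with
    | zero => rwa [pow_zero]
    | succ n ih => rw [pow_succ]; exact mul _ _ ih hx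
  rw [eq_genA_pow_mul_genB_pow g]
  exact mul _ _ (hpow _ a _) (hpow _ b _)

/-- A faithful three-dimensional representation of `G39`. -/
theorem exists_representation_G39 (ζ : ℂ) (hζ : ζ ^ 13 = 1) :
    ∃ ρ : G39 →* GL (Fin 3) ℂ,
      (ρ genA).val = Matrix.diagonal (fun i => ζ ^ 3 ^ i.val) ∧
      (ρ genB).val = Matrix.of fun i j => if j = i + 1 then 1 else 0 := by
  let A : GL (Fin 3) ℂ := Units.ofPowEqOne (Matrix.diagonal (fun i : Fin 3 => ζ ^ 3 ^ i.val)) 13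
    (by
      rw [Matrix.diagonal_pow, ← Matrix.diagonal_one]
      congr 1
      funext i
      rw [Pi.pow_apply, ← pow_mul, mul_comm, pow_mul, hζ, one_pow]) (by norm_num)
  let B : GL (Fin 3) ℂ := Units.ofPowEqOne (Matrix.of fun i j => if j = i + 1 then 1 else 0) 3
    (by
      ext i j
      fin_cases i <;> fin_cases j <;>
        simp [pow_succ, Matrix.mul_apply, Fin.sum_univ_three]) (by norm_num)
  have hBA : B * A = A ^ 3 * B := by
    -- `27 ≡ 1` modulo `13`; this closes the cyclic permutation at its last row.
    have h27 : ζ = (ζ ^ 9) ^ 3 := by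
      rw [← pow_mul, show 9 * 3 = 13 + 13 + 1 from rfl, pow_succ, pow_add, hζ]; ring
    apply Units.ext
    rw [Units.val_mul, Units.val_mul, Units.val_pow_eq_pow_val]
    simp only [A, B, Units.val_ofPowEqOne, Matrix.diagonal_pow]
    ext i j
    rw [Matrix.mul_diagonal, Matrix.diagonal_mul]
    fin_cases i <;> fin_cases j <;> simp <;> first | exact h27 | ring
  obtain ⟨ρ, h1, h2⟩ := exists_monoidHom_G39 A B (Units.ext (by simp [A, Units.pow_ofPowEqOne]))
    (Units.pow_ofPowEqOne _ _) (by rw [hBA, mul_assoc, mul_inv_cancel, mul_one])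
  exact ⟨ρ, by rw [h1]; rfl, by rw [h2]; rfl⟩

open MvPolynomial

/-- A linear action extends to the complement of the zeros of a semi-invariant. -/
theorem exists_localized_action {G : Type*} [Group G] {n : ℕ} (ρ : G →* GL (Fin n) ℂ)
    (h : MvPolynomial (Fin n) ℂ) (hh0 : h ≠ 0)
    (hρ : ∀ g, ∃ c : ℂ, c ≠ 0 ∧ linSubst (ρ g).val h = C c * h) :
    ∃ (S : Type) (_ : CommRing S) (_ : IsDomain S) (_ : Algebra ℂ S)
      (i : MvPolynomial (Fin n) ℂ →ₐ[ℂ] S) (D : G → S →ₐ[ℂ] S), Function.Injective i ∧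
      IsOpenImmersion (specOverMap i).left ∧ IsUnit (i h) ∧
      (∀ g, (D g).comp i = i.comp (linSubst (ρ g).val)) ∧ D 1 = AlgHom.id ℂ S ∧
      ∀ g g', D (g * g') = (D g').comp (D g) := by
  let S := Localization.Away h
  let i : MvPolynomial (Fin n) ℂ →ₐ[ℂ] S := IsScalarTower.toAlgHom ℂ (MvPolynomial (Fin n) ℂ) S
  have hih : IsUnit (i h) := IsLocalization.Away.algebraMap_isUnit h
  have hunit (g : G) : IsUnit ((i.comp (linSubst (ρ g).val)) h) := by
    obtain ⟨c, hc, hg⟩ := hρ g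
    rw [AlgHom.comp_apply, hg, map_mul]
    exact (((isUnit_iff_ne_zero.2 hc).map C).map i).mul hih
  let D (g : G) : S →ₐ[ℂ] S := IsLocalization.Away.liftAlgHom (S := S) h (hunit g)
  have hDi (g : G) : (D g).comp i = i.comp (linSubst (ρ g).val) :=
    AlgHom.ext fun p => IsLocalization.Away.lift_eq (S := S) h (hunit g) p
  have hDi' (g : G) (p : MvPolynomial (Fin n) ℂ) : D g (i p) = i (linSubst (ρ g).val p) :=
    DFunLike.congr_fun (hDi g) p
  have hext {f f' : S →ₐ[ℂ] S} (hf : ∀ p, f (i p) = f' (i p)) : f = f' :=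
    IsLocalization.algHom_ext (Submonoid.powers h) (AlgHom.ext hf)
  refine ⟨S, inferInstance, IsLocalization.Away.isDomain S hh0, inferInstance, i, D,
    IsLocalization.injective S (powers_le_nonZeroDivisors_of_noZeroDivisors hh0),
    inferInstanceAs (IsOpenImmersion (Spec.map (CommRingCat.ofHom
      (algebraMap (MvPolynomial (Fin n) ℂ) (Localization.Away h))))), hih, hDi, ?_, ?_⟩
  · refine hext fun p => ?_
    rw [hDi', map_one, Units.val_one, linSubst_one]
    rfl
  · refine fun g g' => hext fun p => ?_
    rw [hDi', AlgHom.comp_apply, hDi', hDi', map_mul, Units.val_mul, linSubst_mul]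
    rfl

/-- An algebra generated by three elements with product one has dimension at most two. -/
theorem ringKrullDim_adjoin_le_two {S : Type*} [CommRing S] [Algebra ℂ S] (u : Fin 3 → S)
    (hu : u 0 * u 1 * u 2 = 1) : ringKrullDim (Algebra.adjoin ℂ (Set.range u)) ≤ 2 := by
  rw [Algebra.adjoin_range_eq_range_aeval]
  -- The algebra is a quotient of `ℂ[x₀, x₁, x₂] / (f)`, and dividing by a nonzerodivisor lowers the
  -- dimension by at least one.
  let f : MvPolynomial (Fin 3) ℂ := X 0 * X 1 * X 2 - 1
  have hf0 : f ≠ 0 := fun h => by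
    have := congrArg (MvPolynomial.eval 0) h
    simp [f] at this
  let π := (aeval u : MvPolynomial (Fin 3) ℂ →ₐ[ℂ] S).rangeRestrict
  have hπf : ∀ p ∈ Ideal.span {f}, π p = 0 := by
    intro p hp
    obtain ⟨q, rfl⟩ := Ideal.mem_span_singleton.1 hp
    have : π f = 0 := Subtype.ext (by simp [π, f, hu])
    rw [map_mul, this, zero_mul]
  have hle := ringKrullDim_le_of_surjective (Ideal.Quotient.lift (Ideal.span {f}) π.toRingHom hπf)
    (Ideal.Quotient.lift_surjective_of_surjective _ _ (AlgHom.rangeRestrict_surjective _))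
  have h3 := ringKrullDim_quotient_succ_le_of_nonZeroDivisor (mem_nonZeroDivisors_of_ne_zero hf0)
  rw [MvPolynomial.ringKrullDim_of_isNoetherianRing, ringKrullDim_eq_zero_of_field, zero_add,
    Nat.card_eq_fintype_card, Fintype.card_fin] at h3
  refine hle.trans ?_
  exact ENat.WithBot.add_le_add_one_right_iff.1 (h3.trans (by norm_num))

/-- The coordinates are inverted by localizing at their product, a semi-invariant. The ratios `u k =
x (k + 1) / x k` have product one and generate the coordinate ring of a torus in the projective
plane; `a` scales them and `b` permutes them cyclically. Only dimension at most two is needed, the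
lower bound supplying equality. -/
theorem exists_linearizable_surface : ∃ (X : Over SpecC) (α : G39 →* Aut X),
    IsVariety X ∧ Function.Injective α ∧ IsLinearizable α ∧ topologicalKrullDim X.left ≤ 2 := by
  obtain ⟨ζ, hζ⟩ : ∃ ζ : ℂ, IsPrimitiveRoot ζ 13 :=
    ⟨_, Complex.isPrimitiveRoot_exp 13 (by norm_num)⟩
  have hζ0 : ζ ≠ 0 := hζ.ne_zero (by norm_num)
  obtain ⟨ρ, hρA, hρB⟩ := exists_representation_G39 ζ hζ.pow_eq_one
  have hLA (k : Fin 3) : linSubst (ρ genA).val (X k) = C (ζ ^ 3 ^ k.val) * X k := by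
    rw [hρA, linSubst, aeval_X]
    fin_cases k <;> simp [Fin.sum_univ_three]
  have hLB (k : Fin 3) : linSubst (ρ genB).val (X k) = X (k + 1) := by
    rw [hρB, linSubst, aeval_X]
    simp
  have hLh (g : G39) : ∃ c : ℂ, c ≠ 0 ∧ linSubst (ρ g).val (∏ k, X k) = C c * ∏ k, X k := by
    induction g using G39_induction with
    | one => exact ⟨1, one_ne_zero, by rw [map_one, Units.val_one, linSubst_one]; simp⟩
    | mul g g' hg hg' =>
      obtain ⟨c, hc, hg⟩ := hg
      obtain ⟨c', hc', hg'⟩ := hg'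
      refine ⟨c * c', mul_ne_zero hc hc', ?_⟩
      rw [map_mul, Units.val_mul, linSubst_mul, AlgHom.comp_apply, hg, map_mul, hg',
        MvPolynomial.algHom_C, algebraMap_eq, C_mul, mul_assoc]
    | a => exact ⟨∏ k : Fin 3, ζ ^ 3 ^ k.val, Finset.prod_ne_zero_iff.2 fun k _ => pow_ne_zero _ hζ0,
        by rw [map_prod, map_prod, ← Finset.prod_mul_distrib]
           exact Finset.prod_congr rfl fun k _ => hLA k⟩
    | b => exact ⟨1, one_ne_zero, by
        rw [map_prod, C_1, one_mul]
        exact (Finset.prod_congr rfl fun k _ => hLB k).trans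
          (Equiv.prod_comp (Equiv.addRight (1 : Fin 3)) _)⟩
  obtain ⟨S, _, _, _, i, D, hi, hopen, hih, hDi, hD1, hDmul⟩ := exists_localized_action ρ _
    (Finset.prod_ne_zero_iff.2 fun k _ => X_ne_zero k) hLh
  have hDi' (g : G39) (p : MvPolynomial (Fin 3) ℂ) : D g (i p) = i (linSubst (ρ g).val p) :=
    DFunLike.congr_fun (hDi g) p
  have hxu (k : Fin 3) : IsUnit (i (X k)) :=
    isUnit_of_dvd_unit (map_dvd i (Finset.dvd_prod_of_mem _ (Finset.mem_univ k))) hih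
  have hu (k : Fin 3) : ∃ u : S, u * i (X k) = i (X (k + 1)) :=
    ⟨i (X (k + 1)) * ↑(hxu k).unit⁻¹, by rw [mul_assoc, IsUnit.val_inv_mul, mul_one]⟩
  choose u hu using hu
  have hu1 : u 0 * u 1 * u 2 = 1 := by
    have h0 : u 0 * i (X 0) = i (X 1) := hu 0
    have h1 : u 1 * i (X 1) = i (X 2) := hu 1
    have h2 : u 2 * i (X 2) = i (X 0) := hu 2
    refine mul_right_cancel₀ (hxu 0).ne_zero ?_
    calc u 0 * u 1 * u 2 * i (X 0) = u 2 * (u 1 * (u 0 * i (X 0))) := by ring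
      _ = 1 * i (X 0) := by rw [h0, h1, h2, one_mul]
  have hDAu (k : Fin 3) : ∃ c : ℂ, c * ζ ^ 3 ^ k.val = ζ ^ 3 ^ (k + 1).val ∧
      D genA (u k) = algebraMap ℂ S c * u k := by
    have hc := div_mul_cancel₀ (ζ ^ 3 ^ (k + 1).val) (pow_ne_zero (3 ^ k.val) hζ0)
    refine ⟨ζ ^ 3 ^ (k + 1).val / ζ ^ 3 ^ k.val, hc, ?_⟩
    have h1 := congrArg (D genA) (hu k)
    have hCi (c : ℂ) : i (C c) = algebraMap ℂ S c := i.commutes c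
    rw [map_mul, hDi', hDi', hLA, hLA, map_mul, map_mul, ← hu k, hCi, hCi, ← hc, map_mul] at h1
    refine mul_right_cancel₀ (mul_ne_zero (hxu k).ne_zero
      (((isUnit_iff_ne_zero.2 (pow_ne_zero (3 ^ k.val) hζ0)).map (algebraMap ℂ S)).ne_zero)) ?_
    linear_combination h1
  have hDBu (k : Fin 3) : D genB (u k) = u (k + 1) := by
    have h1 := congrArg (D genB) (hu k)
    rw [map_mul, hDi', hDi', hLB, hLB, ← hu (k + 1)] at h1
    exact mul_right_cancel₀ (hxu (k + 1)).ne_zero h1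
  let R : Subalgebra ℂ S := Algebra.adjoin ℂ (Set.range u)
  have huR (k : Fin 3) : u k ∈ R := Algebra.subset_adjoin ⟨k, rfl⟩
  have hDR (g : G39) : R ≤ R.comap (D g) := by
    induction g using G39_induction with
    | one => rw [hD1]; exact le_rfl
    | mul g g' hg hg' => rw [hDmul]; exact fun x hx => hg' (hg hx)
    | a =>
      refine Algebra.adjoin_le ?_
      rintro _ ⟨k, rfl⟩
      obtain ⟨c, -, hc⟩ := hDAu k
      rw [Subalgebra.coe_comap, Set.mem_preimage, hc]
      exact mul_mem (R.algebraMap_mem c) (huR k)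
    | b =>
      refine Algebra.adjoin_le ?_
      rintro _ ⟨k, rfl⟩
      rw [Subalgebra.coe_comap, Set.mem_preimage, hDBu]
      exact huR _
  let F (g : G39) : R →ₐ[ℂ] R := ((D g).comp R.val).codRestrict R fun x => hDR g x.2
  have hF1 : F 1 = AlgHom.id ℂ R := AlgHom.ext fun x => Subtype.ext (DFunLike.congr_fun hD1 x.1)
  have hFmul (g g' : G39) : F (g * g') = (F g').comp (F g) :=
    AlgHom.ext fun x => Subtype.ext (DFunLike.congr_fun (hDmul g g') x.1)
  have hfin : Algebra.FiniteType ℂ R :=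
    R.fg_iff_finiteType.1 ⟨(Set.finite_range u).toFinset, by rw [Set.Finite.coe_toFinset]⟩
  refine ⟨specOver R, specAction F hF1 hFmul, isVariety_specOver R,
    injective_of_map_genA_ne_one _ fun hA => ?_,
    isLinearizable_specAction F hF1 hFmul ρ D i hi hopen R.val Subtype.val_injective hDi
      fun g => rfl, ?_⟩
  · have h1 : specOverMap (F genA) = specOverMap (AlgHom.id ℂ R) := by
      rw [specOverMap_id]
      exact congrArg (fun e : specOver R ≅ specOver R => e.hom) hA
    have h1' := DFunLike.congr_fun (specOverMap_injective h1) (⟨u 0, huR 0⟩ : R)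
    have h2 : D genA (u 0) = u 0 := congrArg Subtype.val h1'
    obtain ⟨c, hc, hcu⟩ := hDAu 0
    have hu0 : u 0 ≠ 0 := fun h0 => by simp [h0] at hu1
    have hc1 : c = 1 := by
      apply (algebraMap ℂ S).injective
      rw [map_one]
      exact mul_right_cancel₀ hu0 (by rw [← hcu, h2, one_mul])
    rw [hc1] at hc
    -- `a` multiplies `u 0 = x₁ / x₀` by `ζ³ / ζ = ζ²`, which is not `1`.
    have h3 : ζ ^ 2 = 1 := by
      refine mul_right_cancel₀ hζ0 ?_
      rw [one_mul, ← pow_succ]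
      simpa using hc.symm
    have := (hζ.pow_eq_one_iff_dvd 2).1 h3
    omega
  · change topologicalKrullDim (PrimeSpectrum R) ≤ 2
    rw [PrimeSpectrum.topologicalKrullDim_eq_ringKrullDim]
    exact ringKrullDim_adjoin_le_two u hu1

theorem essentialDimension_G39 : essentialDimension G39 = 2 := by
  apply le_antisymm
  · obtain ⟨X, α, hX, hα, hlin, hdim⟩ := exists_linearizable_surface
    exact sInf_le ⟨X, α, hX, hα, hlin, le_antisymm hdim (two_le_topologicalKrullDim hX α hα hlin)⟩
  · refine le_sInf ?_
    rintro d ⟨X, α, hX, hα, hlin, hdim⟩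
    have h := two_le_topologicalKrullDim hX α hα hlin
    rw [hdim] at h
    exact WithBot.coe_le_coe.1 h

/-! ### The 13-torsion of the torus and the embedding into `T ⋊ 𝒢₃` -/

theorem mem_torsion13 {t : Torus} : t ∈ torsion13 ↔ ∀ i, t i ^ 13 = 1 := by
  rw [torsion13, MonoidHom.mem_ker]
  exact funext_iff

theorem nonempty_torsion13_mulEquiv : Nonempty (torsion13 ≃* Cyc 13 × Cyc 13) := by
  have e₁ : torsion13 ≃* (rootsOfUnity 13 ℂ × rootsOfUnity 13 ℂ) :=
    { toFun := fun t => (⟨t.1 0, (mem_rootsOfUnity _ _).2 (mem_torsion13.1 t.2 0)⟩,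
        ⟨t.1 1, (mem_rootsOfUnity _ _).2 (mem_torsion13.1 t.2 1)⟩)
      invFun := fun p => ⟨![p.1.1, p.2.1], mem_torsion13.2 fun i => by
        fin_cases i
        · exact (mem_rootsOfUnity _ _).1 p.1.2
        · exact (mem_rootsOfUnity _ _).1 p.2.2⟩
      left_inv := fun t => by
        ext i
        fin_cases i <;> rfl
      right_inv := fun p => rfl
      map_mul' := fun s t => rfl }
  have e₂ : rootsOfUnity 13 ℂ ≃* Cyc 13 := mulEquivOfCyclicCardEq (by
    rw [Complex.card_rootsOfUnity]; simp)
  exact ⟨e₁.trans (e₂.prodCongr e₂)⟩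

theorem inr_conj_inl (g : G3) (t : Torus) :
    (SemidirectProduct.inr g * SemidirectProduct.inl t * (SemidirectProduct.inr g)⁻¹ : TG3) =
      SemidirectProduct.inl (torusAction g t) := by
  rw [← map_inv]
  exact (SemidirectProduct.inl_aut g t).symm

theorem torusAction_matM (t : Torus) : torusAction matM t = ![(t 1)⁻¹, t 0 * (t 1)⁻¹] := by
  change monomialMap matM.val t = _
  funext i
  fin_cases i <;> simp [monomialMap, matM, Fin.prod_univ_two]

theorem exists_embedding_TG3 : ∃ (a₁ a₂ : Torus) (ι : G39 →* TG3),
      Subgroup.closure {a₁, a₂} = torsion13 ∧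
      torusAction matM a₁ = a₂⁻¹ ∧
      torusAction matM a₂ = a₁ * a₂⁻¹ ∧
      Function.Injective ι ∧
      ι genA = SemidirectProduct.inl (a₁ * a₂ ^ 3) ∧
      ι genB = SemidirectProduct.inr mInG3 ∧
      ι.range ≤ subgroupH ∧
      (Nat.card ↥(ι.range ⊓ torusInTG3)).Coprime 3 := by
  obtain ⟨ζ, hζ⟩ : ∃ ζ : ℂˣ, IsPrimitiveRoot ζ 13 := by
    have h := Complex.isPrimitiveRoot_exp 13 (by norm_num)
    exact ⟨(h.isUnit (by norm_num)).unit, IsPrimitiveRoot.coe_units_iff.1 h⟩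
  -- Given `a₁ = (ζ, 1)`, the relation `m a₁ = a₂⁻¹` dictates `a₂ = (1, ζ⁻¹)`.
  let a₁ : Torus := ![ζ, 1]
  let a₂ : Torus := ![1, ζ⁻¹]
  have h13 : ζ ^ 13 = 1 := hζ.pow_eq_one
  have hm₁ : torusAction matM a₁ = a₂⁻¹ := by
    rw [torusAction_matM]; funext i; fin_cases i <;> simp [a₁, a₂]
  have hm₂ : torusAction matM a₂ = a₁ * a₂⁻¹ := by
    rw [torusAction_matM]; funext i; fin_cases i <;> simp [a₁, a₂]
  have ha₁ : a₁ ∈ torsion13 := mem_torsion13.2 fun i => by fin_cases i <;> simp [a₁, h13]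
  have ha₂ : a₂ ∈ torsion13 := mem_torsion13.2 fun i => by fin_cases i <;> simp [a₂, h13]
  have hc : a₁ * a₂ ^ 3 ∈ torsion13 := mul_mem ha₁ (pow_mem ha₂ 3)
  have hc13 : (a₁ * a₂ ^ 3) ^ 13 = 1 := hc
  obtain ⟨ι, hιA, hιB⟩ := exists_monoidHom_G39 (H := TG3) (SemidirectProduct.inl (a₁ * a₂ ^ 3))
    (SemidirectProduct.inr mInG3) (by rw [← map_pow, hc13, map_one])
    (by rw [← map_pow, ← orderOf_mInG3, pow_orderOf_eq_one, map_one])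
    (by
      rw [inr_conj_inl, ← map_pow]
      congr 1
      change torusAction matM (a₁ * a₂ ^ 3) = _
      rw [map_mul, map_pow, hm₁, hm₂]
      funext i
      fin_cases i
      · simp [a₁, a₂]
      -- With `c = a₁ a₂³ = (ζ, ζ⁻³)`, `m c = (ζ³, ζ⁴)` and `c³ = (ζ³, ζ⁻⁹)`; these agree because `4
      -- + 9 = 13`.
      · have : ζ * ζ ^ 3 = (ζ ^ 9)⁻¹ := by
          rw [eq_inv_iff_mul_eq_one, ← h13]; simp only [← pow_succ', ← pow_add]
        simpa [a₁, a₂, ← pow_mul] using this)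
  have hne : ι genA ≠ 1 := by
    rw [hιA]
    intro h
    have h1 : a₁ * a₂ ^ 3 = 1 := SemidirectProduct.inl_injective (h.trans (map_one _).symm)
    have h2 : ζ = 1 := by simpa [a₁, a₂] using congrFun h1 0
    exact hζ.ne_one (by norm_num) h2
  have hinj := injective_of_map_genA_ne_one ι hne
  have hgen : Subgroup.closure {a₁, a₂} = torsion13 := by
    apply le_antisymm
    · rw [Subgroup.closure_le]
      rintro _ (rfl | rfl)
      exacts [ha₁, ha₂]
    · intro t ht
      rw [mem_torsion13] at ht
      have hpow (z : ℂˣ) (hz : z ^ 13 = 1) : ∃ n : ℕ, ζ ^ n = z := by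
        obtain ⟨n, -, hn⟩ := (IsPrimitiveRoot.coe_units_iff.2 hζ).eq_pow_of_pow_eq_one
          (ξ := (z : ℂ)) (by rw [← Units.val_pow_eq_pow_val, hz, Units.val_one])
        exact ⟨n, Units.ext (by rw [Units.val_pow_eq_pow_val, hn])⟩
      obtain ⟨m, hm⟩ := hpow _ (ht 0)
      obtain ⟨n, hn⟩ := hpow (t 1)⁻¹ (by rw [inv_pow, ht 1, inv_one])
      have : t = a₁ ^ m * a₂ ^ n := by
        funext i
        fin_cases i
        · simp [a₁, a₂, hm]
        · simp [a₁, a₂, hn]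
      rw [this]
      exact mul_mem (pow_mem (Subgroup.subset_closure (by simp)) _)
        (pow_mem (Subgroup.subset_closure (by simp)) _)
  refine ⟨a₁, a₂, ι, hgen, hm₁, hm₂, hinj, hιA, hιB, ?_, ?_⟩
  · rintro _ ⟨g, rfl⟩
    induction g using G39_induction with
    | one => rw [map_one]; exact one_mem _
    | mul g h hg hh => rw [map_mul]; exact mul_mem hg hh
    | a => rw [hιA]; exact Subgroup.mem_sup_left ⟨_, hc, rfl⟩
    | b => rw [hιB]; exact Subgroup.mem_sup_right (Subgroup.mem_zpowers _)
  -- Projecting an image element lying in `T` to `𝒢₃` kills its power of `m`, leaving a power of `ι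
  -- genA`. So the order of the intersection divides `13`.
  · have hle : ι.range ⊓ torusInTG3 ≤ Subgroup.zpowers (ι genA) := by
      rintro _ ⟨⟨g, rfl⟩, ⟨t, ht⟩⟩
      rw [eq_genA_pow_mul_genB_pow g] at ht ⊢
      simp only [map_mul, map_pow] at ht ⊢
      have h1 := congrArg SemidirectProduct.rightHom ht
      rw [SemidirectProduct.rightHom_inl, hιA, hιB, map_mul, map_pow, map_pow,
        SemidirectProduct.rightHom_inl, SemidirectProduct.rightHom_inr, one_pow, one_mul] at h1
      rw [hιB, ← map_pow SemidirectProduct.inr, ← h1, map_one, mul_one]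
      exact pow_mem (Subgroup.mem_zpowers _) _
    have hdvd := Subgroup.card_dvd_of_le hle
    have : Fact (Nat.Prime 13) := ⟨by norm_num⟩
    rw [Nat.card_zpowers, orderOf_injective ι hinj,
      orderOf_eq_prime genA_pow (by decide)] at hdvd
    exact Nat.Coprime.coprime_dvd_left hdvd (by norm_num)

end EssDim

end

/-- The group `G = C₁₃ ⋊ C₃` has essential dimension two. It is neither cyclic nor dihedral of order
`2n` with `n` odd, and it embeds into `T[13] ⋊ ⟨m⟩ ⊂ T ⋊ 𝒢₃`, by `a ↦ a₁ a₂³` and `b ↦ m`, with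
intersection with `T` of order prime to three. -/
theorem mainTheorem5 :
    EssDim.essentialDimension EssDim.G39 = 2 ∧
    ¬ IsCyclic EssDim.G39 ∧
    (∀ n : ℕ, Odd n → IsEmpty (EssDim.G39 ≃* DihedralGroup n)) ∧
    Nonempty (EssDim.torsion13 ≃* EssDim.Cyc 13 × EssDim.Cyc 13) ∧
    orderOf EssDim.mInG3 = 3 ∧
    ∃ (a₁ a₂ : EssDim.Torus) (ι : EssDim.G39 →* EssDim.TG3),
      Subgroup.closure {a₁, a₂} = EssDim.torsion13 ∧
      EssDim.torusAction EssDim.matM a₁ = a₂⁻¹ ∧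
      EssDim.torusAction EssDim.matM a₂ = a₁ * a₂⁻¹ ∧
      Function.Injective ι ∧
      ι EssDim.genA = SemidirectProduct.inl (a₁ * a₂ ^ 3) ∧
      ι EssDim.genB = SemidirectProduct.inr EssDim.mInG3 ∧
      ι.range ≤ EssDim.subgroupH ∧
      (Nat.card ↥(ι.range ⊓ EssDim.torusInTG3)).Coprime 3 := by
  obtain ⟨a₁, a₂, ι, h⟩ := EssDim.exists_embedding_TG3
  exact ⟨EssDim.essentialDimension_G39, EssDim.not_isCyclic_G39,
    fun n _ => EssDim.isEmpty_G39_mulEquiv_dihedralGroup n, EssDim.nonempty_torsion13_mulEquiv,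
    EssDim.orderOf_mInG3, a₁, a₂, ι, h⟩
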